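/- Let $\varphi:(0,\infty)\to(0,\infty)$ satisfy: (i) $\varphi\in C^1((0,\infty))$; (ii) $(s\varphi(s))'>0$ for all $s>0$; (iii) the range of $s\mapsto s\varphi(s)$ is $(0,\infty)$; (iv) there are $C_1,C_2,s_0>0$ and $r>-1$ with $C_1s^r\le (s\varphi(s))'\le C_2s^r$ for $s\in(0,s_0)$, and if $r=0$ then moreover $\lim_{s\to0^+}\varphi(s)$ exists, is finite and positive, and $\lim_{s\to0^+}s\varphi'(s)=0$; (v) for some $s_1>s_0$, either $\varphi'(s)\ge0$ for all $s\ge s_1$ or $\varphi'(s)\le 0$ for all $s\ge s_1$; (vi) $s\mapsto|s\varphi'(s)/\varphi(s)|$ is non-decreasing on $(0,\infty)$. Let $\Lambda:(0,\infty)\to\mathbb R$ be the function defined by $$\Lambda\big(s\sqrt{\varphi(s)}\big)=-\frac{s\varphi'(s)}{s\varphi'(s)+2\varphi(s)}\qquad(s>0),$$ put $\Lambda_\infty^2=\sup_{t>0}\Lambda^2(t)$, and assume $\Lambda_\infty^2<1$. Let $-\infty\le a<b\le\infty$ and $m\ge1$. For an $m\times m$ matrix $\mathscr B$ with entries in $L^1_{\mathrm{loc}}((a,b);\mathbb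 C)$, the operator $u\mapsto(\mathscr Bu')'$ is called $L^\Phi$-dissipative if $$\operatorname{Re}\int_a^b\langle\mathscr B u',(\varphi(|u|)u)'\rangle\,dx\ge0$$ for every $u\in[C^1_c((a,b))]^m$ (complex valued) such that $\varphi(|u|)u\in[C^1_c((a,b))]^m$ (where $\varphi(|u|)u:=0$ at the zeros of $u$). Let $\mathscr A$ be a real $m\times m$ matrix function on $(a,b)$, with entries in $L^1_{\mathrm{loc}}((a,b))$ and symmetric almost everywhere, let $\mu_1(x)$ and $\mu_m(x)$ be the smallest and the largest eigenvalue of $\mathscr A(x)$, and let $Au=(\mathscr Au')'$. Then there exists $\kappa>0$ such that $A-\kappa I\,d^2/dx^2$, i.e. $u\mapsto((\mathscr A-\kappa I)u')'$, is $L^\Phi$-dissipative if and only if $$\operatorname*{ess\,inf}_{x\in(a,b)}\Big[\big(1+\sqrt{1-\Lambda_\infty^2}\big)\mu_1(x)-\big(1-\sqrt{1-\Lambda_\infty^2}\big)\mu_m(x)\Big]>0. \tag{1}$$ If $m=2$, condition (1) is equivalent to $$\operatorname*{ess\,inf}_{x\in(a,b)}\Big[\sqrt{1-\Lambda_\infty^2}\,\operatorname{tr}\mathscr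 A(x)-\sqrt{(\operatorname{tr}\mathscr A(x))^2-4\det\mathscr A(x)}\Big]>0.$$ -/

import Mathlib

open MeasureTheory Set Filter Topology

namespace FunctionalDissipativity

/-- The standing assumptions on the positive function `φ : (0, ∞) → (0, ∞)`
(values of `φ` outside `(0, ∞)` are irrelevant). -/
structure IsAdmissible (φ : ℝ → ℝ) : Prop where
  pos : ∀ s, 0 < s → 0 < φ s
  contDiffOn : ContDiffOn ℝ 1 φ (Ioi 0)
  deriv_pos : ∀ s, 0 < s → 0 < deriv (fun t => t * φ t) s
  range_eq : (fun s => s * φ s) '' Ioi 0 = Ioi 0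
  /-- Power behaviour of `(s φ(s))'` at `0`, and constant sign of `φ'` near infinity. -/
  growth : ∃ C₁ C₂ r s₀ : ℝ, 0 < C₁ ∧ 0 < C₂ ∧ -1 < r ∧ 0 < s₀ ∧
    (∀ s ∈ Ioo 0 s₀, C₁ * s ^ r ≤ deriv (fun t => t * φ t) s ∧
      deriv (fun t => t * φ t) s ≤ C₂ * s ^ r) ∧
    (r = 0 → (∃ φ₀ : ℝ, 0 < φ₀ ∧ Tendsto φ (𝓝[>] 0) (𝓝 φ₀)) ∧
      Tendsto (fun s => s * deriv φ s) (𝓝[>] 0) (𝓝 0)) ∧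
    ∃ s₁ : ℝ, s₀ < s₁ ∧
      ((∀ s, s₁ ≤ s → 0 ≤ deriv φ s) ∨ (∀ s, s₁ ≤ s → deriv φ s ≤ 0))
  monotone_abs : MonotoneOn (fun s => |s * deriv φ s / φ s|) (Ioi 0)

/-- `- s φ'(s) / (s φ'(s) + 2 φ(s))`. -/
noncomputable def lambdaRatio (φ : ℝ → ℝ) (s : ℝ) : ℝ :=
  -((s * deriv φ s) / (s * deriv φ s + 2 * φ s))

/-- The function `Λ` on `(0, ∞)`, determined by
`Λ (s √φ(s)) = - s φ'(s) / (s φ'(s) + 2 φ(s))` for `s > 0` (see `Lambda_apply`). -/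
noncomputable def Lambda (φ : ℝ → ℝ) (t : ℝ) : ℝ :=
  lambdaRatio φ (Function.invFunOn (fun s => s * √(φ s)) (Ioi 0) t)

/-- `Λ_∞² = sup_{t > 0} Λ(t)²`. -/
noncomputable def LambdaInftySq (φ : ℝ → ℝ) : ℝ :=
  ⨆ t : Ioi (0 : ℝ), Lambda φ t ^ 2

theorem IsAdmissible.injOn {φ : ℝ → ℝ} (h : IsAdmissible φ) :
    InjOn (fun s => s * √(φ s)) (Ioi 0) := by
  have hc : ContinuousOn (fun s => s * φ s) (Ioi 0) :=
    continuousOn_id.mul h.contDiffOn.continuousOn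
  have hm : StrictMonoOn (fun s => s * φ s) (Ioi 0) := by
    apply strictMonoOn_of_deriv_pos (convex_Ioi 0) hc
    intro x hx
    rw [interior_Ioi] at hx
    exact h.deriv_pos x hx
  have hs : StrictMonoOn (fun s => s * √(φ s)) (Ioi 0) := by
    intro x hx y hy hxy
    have hx' : 0 < x := hx
    have hy' : 0 < y := hy
    have h1 : x * φ x < y * φ y := hm hx hy hxy
    have h2 : 0 < x * φ x := mul_pos hx' (h.pos x hx')
    have h3 : x * (x * φ x) < y * (y * φ y) := mul_lt_mul'' hxy h1 hx'.le h2.le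
    have e : ∀ z, 0 < z → z * √(φ z) = √(z * (z * φ z)) := by
      intro z hz
      rw [← mul_assoc, Real.sqrt_mul (mul_self_nonneg z), Real.sqrt_mul_self hz.le]
    change x * √(φ x) < y * √(φ y)
    rw [e x hx', e y hy']
    exact Real.sqrt_lt_sqrt (mul_pos hx' h2).le h3
  exact hs.injOn

/-- The defining relation of `Λ`. -/
theorem Lambda_apply {φ : ℝ → ℝ} (h : IsAdmissible φ) {s : ℝ} (hs : 0 < s) :
    Lambda φ (s * √(φ s)) = -((s * deriv φ s) / (s * deriv φ s + 2 * φ s)) := by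
  have : Function.invFunOn (fun s => s * √(φ s)) (Ioi 0) (s * √(φ s)) = s :=
    h.injOn.leftInvOn_invFunOn hs
  simp only [Lambda, lambdaRatio, this]

/-- `w ∈ [C¹_c(I)]^m`, functions on the open set `I` being extended by zero. -/
def IsC1c {m : ℕ} (I : Set ℝ) (w : ℝ → EuclideanSpace ℂ (Fin m)) : Prop :=
  ContDiff ℝ 1 w ∧ HasCompactSupport w ∧ tsupport w ⊆ I

/-- `L^Φ`-dissipativity of the ordinary differential operator `u ↦ (B u')'` on the open interval
`I`: `Re ∫_I ⟨B u', (φ(|u|) u)'⟩ dx ≥ 0` for all `u ∈ [C¹_c(I)]^m` with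
`φ(|u|) u ∈ [C¹_c(I)]^m`. (Mathlib's `inner` is linear in its second argument.) -/
def IsLPhiDissipative {m : ℕ} (φ : ℝ → ℝ) (I : Set ℝ)
    (B : ℝ → Matrix (Fin m) (Fin m) ℂ) : Prop :=
  ∀ u : ℝ → EuclideanSpace ℂ (Fin m),
    IsC1c I u → IsC1c I (fun x => φ ‖u x‖ • u x) →
    0 ≤ (∫ x in I, inner ℂ (deriv (fun y => φ ‖u y‖ • u y) x)
      (Matrix.toEuclideanLin (B x) (deriv u x))).re

/-- The smallest (real) eigenvalue of a matrix. -/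
noncomputable def minEigenvalue {m : ℕ} (M : Matrix (Fin m) (Fin m) ℝ) : ℝ :=
  sInf {μ : ℝ | Module.End.HasEigenvalue (Matrix.toLin' M) μ}

/-- The largest (real) eigenvalue of a matrix. -/
noncomputable def maxEigenvalue {m : ℕ} (M : Matrix (Fin m) (Fin m) ℝ) : ℝ :=
  sSup {μ : ℝ | Module.End.HasEigenvalue (Matrix.toLin' M) μ}

/-- The bounded or unbounded open interval `(a, b)` with `-∞ ≤ a, b ≤ ∞`. -/
def openInterval (a b : EReal) : Set ℝ :=
  {x : ℝ | a < (x : EReal) ∧ (x : EReal) < b}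

/-- The essential infimum over `I`, with values in `[-∞, ∞]`, of a real function. -/
noncomputable def essInfOn (I : Set ℝ) (f : ℝ → ℝ) : EReal :=
  essInf (fun x => (f x : EReal)) (volume.restrict I)

end FunctionalDissipativity

/-! Where `u ≠ 0`, put `w = u/|u|`, `s = |u|` and `g = sφ'(s)/φ(s)`. For `T = M(x)` and `S(x, y) =
Re ⟨x, T y⟩`, the integrand of the dissipativity form at `v = u'` is `φ(s) (S(v, v) + g Re⟨w, v⟩
S(w, v))`. A shift of `v` along `w` removes the mixed term and leaves `S(y, y) - λ² Re⟨w, y⟩² S(w,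
w)`, with `λ = -g/(g+2)` the value of `Λ` at `s√φ(s)`. Hence the pointwise condition is `Λ_∞² Re⟨w,
y⟩² S(w, w) ≤ S(y, y)` for all `y` and all unit `w` (`forall_reForm_nonneg_iff`).

For symmetric `T` with positive extreme eigenvalues `p ≤ q`, Kantorovich's inequality makes this
equivalent to `Λ_∞² (p+q)² ≤ 4pq`, that is, to `(1-σ) q ≤ (1+σ) p` with `σ = √(1 - Λ_∞²)`
(`reForm_le_of_spectrum`, `spectrum_le_of_reForm_le`). Subtracting `κI` lowers `(1+σ)μ₁ - (1-σ)μ_m`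
by exactly `2σκ`, so some `κ > 0` is admissible iff this quantity has a positive essential lower
bound.

The integral inequality yields the pointwise one at Lebesgue points of the coefficients: a test
field equal to a constant `y` near `x₀` is perturbed by `δ ψ((x - x₀)/ε) v` with `ε = δ³`. The
perturbation is uniformly small, yet its energy is of order `1/δ` and dominates the fixed background
energy (`IsLPhiDissipative.re_inner_nlDeriv_nonneg`). Conversely, the pointwise inequality makes the
integrand nonnegative; zeros of `u` are handled by strict positivity of the shifted matrix
(`isLPhiDissipative_of_ae`). -/

namespace FunctionalDissipativity

/-! ### Pointwise algebra: the shifted quadratic form and Kantorovich's inequality. -/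

section QuadraticForm

variable {E : Type*} [NormedAddCommGroup E] [InnerProductSpace ℂ E]

/-- The real bilinear form `Re ⟨x, T y⟩`. -/
noncomputable def reForm (T : E →ₗ[ℂ] E) (x y : E) : ℝ := (inner ℂ x (T y)).re

variable {T : E →ₗ[ℂ] E}

theorem reForm_add_left (x y z : E) : reForm T (x + y) z = reForm T x z + reForm T y z := by
  simp [reForm]

theorem reForm_add_right (x y z : E) : reForm T x (y + z) = reForm T x y + reForm T x z := by
  simp [reForm]

theorem reForm_smul_left (c : ℝ) (x y : E) : reForm T ((c : ℂ) • x) y = c * reForm T x y := by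
  simp [reForm]

theorem reForm_smul_right (c : ℝ) (x y : E) : reForm T x ((c : ℂ) • y) = c * reForm T x y := by
  simp [reForm]

theorem reForm_comm (hT : T.IsSymmetric) (x y : E) : reForm T x y = reForm T y x := by
  rw [reForm, reForm, ← hT x y, ← inner_conj_symm, Complex.conj_re]

theorem re_inner_comm (x y : E) : (inner ℂ x y).re = (inner ℂ y x).re := by
  rw [← inner_conj_symm, Complex.conj_re]

theorem re_inner_self_of_norm_eq_one {w : E} (hw : ‖w‖ = 1) : (inner ℂ w w).re = 1 := by
  rw [inner_self_eq_norm_sq_to_K, hw]; simp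

/-- Removing the first order term of the form by a shift in the direction `w`. -/
theorem reForm_shift (hT : T.IsSymmetric) {w : E} (hw : ‖w‖ = 1) {c g : ℝ}
    (hcg : 2 * c + g * (1 + c) = 0) (y : E) {x : E}
    (hx : x = y + ((c * (inner ℂ w y).re : ℝ) : ℂ) • w) :
    reForm T x x + g * (inner ℂ w x).re * reForm T w x =
      reForm T y y - c ^ 2 * (inner ℂ w y).re ^ 2 * reForm T w w := by
  have hwx : (inner ℂ w x).re = (1 + c) * (inner ℂ w y).re := by
    rw [hx, inner_add_right, inner_smul_right, Complex.add_re, Complex.re_ofReal_mul,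
      re_inner_self_of_norm_eq_one hw]
    ring
  rw [hwx]
  subst hx
  simp only [reForm_add_left, reForm_add_right, reForm_smul_left, reForm_smul_right]
  rw [reForm_comm hT y w]
  set t := (inner ℂ w y).re
  have e : g * (1 + c) = -(2 * c) := by linarith
  linear_combination (t * (reForm T w y + c * t * reForm T w w)) * e

/-- The shift `y ↦ y + c Re⟨w, y⟩ w` with `c = -g/(g+2)` is a bijection, since `1 + c = 2/(g+2)`
does not vanish; thus quantifying over `x` and over `y` is the same. -/
theorem forall_reForm_nonneg_iff (hT : T.IsSymmetric) {w : E} (hw : ‖w‖ = 1) {g : ℝ}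
    (hg : -1 < g) :
    (∀ x, 0 ≤ reForm T x x + g * (inner ℂ w x).re * reForm T w x) ↔
      ∀ y, (-(g / (g + 2))) ^ 2 * (inner ℂ w y).re ^ 2 * reForm T w w ≤ reForm T y y := by
  have hg2 : g + 2 ≠ 0 := by linarith
  have hcg : 2 * (-(g / (g + 2))) + g * (1 + (-(g / (g + 2)))) = 0 := by field_simp; ring
  constructor
  · intro h y
    have := h (y + ((-(g / (g + 2)) * (inner ℂ w y).re : ℝ) : ℂ) • w)
    rw [reForm_shift hT hw hcg y rfl] at this
    linarith
  · intro h x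
    set t := (inner ℂ w x).re with ht
    -- Inverse shift: `Re⟨w, x⟩ = (1 + c) Re⟨w, y⟩` forces `Re⟨w, y⟩ = (g+2)/2 · t`.
    have hwy : (inner ℂ w (x - ((-(g / (g + 2)) * ((g + 2) / 2 * t) : ℝ) : ℂ) • w)).re
        = (g + 2) / 2 * t := by
      rw [inner_sub_right, inner_smul_right, Complex.sub_re, Complex.re_ofReal_mul,
        re_inner_self_of_norm_eq_one hw, ← ht]
      field_simp; ring
    rw [ht, reForm_shift hT hw hcg (x - ((-(g / (g + 2)) * ((g + 2) / 2 * t) : ℝ) : ℂ) • w)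
      (by rw [hwy]; abel), sub_nonneg]
    exact h _

/-- A Kantorovich type inequality for a symmetric operator with spectrum in `[p, q]`. -/
theorem kantorovich_reForm [FiniteDimensional ℂ E] (hT : T.IsSymmetric) {p q : ℝ} (hp : 0 < p)
    (hpq : ∀ l : ℝ, Module.End.HasEigenvalue T (l : ℂ) → p ≤ l ∧ l ≤ q) (x w : E) (t : ℝ) :
    0 ≤ reForm T x x - 2 * t * (inner ℂ w x).re +
      t ^ 2 * (((p + q) * ‖w‖ ^ 2 - reForm T w w) / (p * q)) := by
  set b := hT.eigenvectorBasis rfl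
  set l := hT.eigenvalues rfl
  have hl : ∀ i, p ≤ l i ∧ l i ≤ q := fun i => hpq _ (hT.hasEigenvalue_eigenvalues rfl i)
  have hform : ∀ z : E, reForm T z z = ∑ i, l i * ‖inner ℂ (b i) z‖ ^ 2 := by
    intro z
    rw [reForm, ← b.sum_inner_mul_inner, Complex.re_sum]
    refine Finset.sum_congr rfl fun i _ => ?_
    rw [← hT (b i) z, hT.apply_eigenvectorBasis rfl i, inner_smul_left, ← inner_conj_symm z (b i)]
    have : (starRingEnd ℂ) ((l i : ℝ) : ℂ) = l i := Complex.conj_ofReal _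
    change ((starRingEnd ℂ) (inner ℂ (b i) z) * ((starRingEnd ℂ) ((l i : ℝ) : ℂ) *
      inner ℂ (b i) z)).re = _
    rw [this, mul_left_comm, Complex.re_ofReal_mul, Complex.conj_mul']
    norm_cast
  have hinner : (inner ℂ w x).re = ∑ i, (inner ℂ w (b i) * inner ℂ (b i) x).re := by
    rw [← b.sum_inner_mul_inner w x, Complex.re_sum]
  have hnorm : ‖w‖ ^ 2 = ∑ i, ‖inner ℂ (b i) w‖ ^ 2 := (b.sum_sq_norm_inner_right w).symm
  rw [hform, hform, hinner, hnorm]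
  have e : (∑ i, l i * ‖inner ℂ (b i) x‖ ^ 2) -
      2 * t * (∑ i, (inner ℂ w (b i) * inner ℂ (b i) x).re) +
      t ^ 2 * (((p + q) * (∑ i, ‖inner ℂ (b i) w‖ ^ 2) -
        ∑ i, l i * ‖inner ℂ (b i) w‖ ^ 2) / (p * q)) =
      ∑ i, (l i * ‖inner ℂ (b i) x‖ ^ 2 - 2 * t * (inner ℂ w (b i) * inner ℂ (b i) x).re +
        t ^ 2 * (((p + q) * ‖inner ℂ (b i) w‖ ^ 2 - l i * ‖inner ℂ (b i) w‖ ^ 2) / (p * q))) := by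
    simp only [Finset.sum_add_distrib, Finset.sum_sub_distrib, ← Finset.mul_sum,
      ← Finset.sum_div]
  rw [e]
  refine Finset.sum_nonneg fun i _ => ?_
  obtain ⟨h1, h2⟩ := hl i
  have hli : 0 < l i := hp.trans_le h1
  have hq : 0 < q := hli.trans_le h2
  set X := ‖inner ℂ (b i) x‖
  set W := ‖inner ℂ (b i) w‖
  have hre : |(inner ℂ w (b i) * inner ℂ (b i) x).re| ≤ W * X := by
    refine (Complex.abs_re_le_norm _).trans_eq ?_
    rw [norm_mul, norm_inner_symm w (b i)]
  have hre2 : t * (inner ℂ w (b i) * inner ℂ (b i) x).re ≤ |t| * (W * X) := by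
    refine (le_abs_self _).trans ?_
    rw [abs_mul]
    gcongr
  -- On `[p, q]` the convex function `1/l` lies below its chord; equivalently `(l - p)(q - l) ≥ 0`.
  -- The rest is a completed square in each eigencoordinate.
  have hfrac : 1 / l i ≤ (p + q - l i) / (p * q) := by
    rw [div_le_div_iff₀ hli (mul_pos hp hq)]
    nlinarith [mul_nonneg (sub_nonneg.2 h1) (sub_nonneg.2 h2)]
  have h3 : t ^ 2 * W ^ 2 * (1 / l i) ≤ t ^ 2 * W ^ 2 * ((p + q - l i) / (p * q)) := by gcongr
  have h4 : t ^ 2 * (((p + q) * W ^ 2 - l i * W ^ 2) / (p * q)) =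
      t ^ 2 * W ^ 2 * ((p + q - l i) / (p * q)) := by ring
  have h5 : 0 ≤ (l i * X - |t| * W) ^ 2 / l i := by positivity
  have h6 : (l i * X - |t| * W) ^ 2 / l i =
      l i * X ^ 2 - 2 * (|t| * (W * X)) + t ^ 2 * W ^ 2 * (1 / l i) := by
    field_simp
    rw [← sq_abs t]
    ring
  rw [h4]
  linarith

/-- If the spectrum lies in `[p, q]`, `p > 0`, and `L ≤ 4 p q / (p + q)²`, the form satisfies the
pointwise dissipativity inequality. -/
theorem reForm_le_of_spectrum [FiniteDimensional ℂ E] (hT : T.IsSymmetric) {p q L : ℝ}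
    (hp : 0 < p) (hq : p ≤ q)
    (hpq : ∀ l : ℝ, Module.End.HasEigenvalue T (l : ℂ) → p ≤ l ∧ l ≤ q)
    (hL0 : 0 ≤ L) (hL : L * (p + q) ^ 2 ≤ 4 * (p * q)) {w : E} (hw : ‖w‖ = 1) (x : E) :
    L * (inner ℂ w x).re ^ 2 * reForm T w w ≤ reForm T x x := by
  have hpq0 : 0 < p * q := mul_pos hp (hp.trans_le hq)
  have hK := kantorovich_reForm hT hp hpq x w
  set b := reForm T w w
  set r := (inner ℂ w x).re
  set Sx := reForm T x x
  rw [hw] at hK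
  have hSx : 0 ≤ Sx := by simpa using hK 0
  rcases le_or_gt b 0 with hb | hb
  · exact (mul_nonpos_of_nonneg_of_nonpos (by positivity) hb).trans hSx
  -- With this `t` the linear term is `-2Lbr²`, while the quadratic term is at most `Lbr²` because
  -- `b(p+q-b) ≤ (p+q)²/4`.
  have h := hK (L * b * r)
  have h1 : L * b * (p + q - b) ≤ p * q := by
    have : b * (p + q - b) ≤ (p + q) ^ 2 / 4 := by nlinarith [sq_nonneg (p + q - 2 * b)]
    nlinarith [mul_le_mul_of_nonneg_left this hL0]
  have h2 : (L * b * r) ^ 2 * (((p + q) * 1 ^ 2 - b) / (p * q)) ≤ L * b * r ^ 2 := by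
    have : (L * b * r) ^ 2 * (((p + q) * 1 ^ 2 - b) / (p * q)) =
      (L * b * r ^ 2) * ((L * b * (p + q - b)) / (p * q)) := by ring
    rw [this]
    exact mul_le_of_le_one_right (by positivity) ((div_le_one hpq0).2 h1)
  nlinarith

/-- Converse of `reForm_le_of_spectrum`. -/
theorem spectrum_le_of_reForm_le (hT : T.IsSymmetric) {p q L : ℝ} (hpq : p ≤ q)
    (hL1 : L < 1) (hp : Module.End.HasEigenvalue T (p : ℂ))
    (hq : Module.End.HasEigenvalue T (q : ℂ))
    (h : ∀ w : E, ‖w‖ = 1 → ∀ x, L * (inner ℂ w x).re ^ 2 * reForm T w w ≤ reForm T x x) :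
    (1 - √(1 - L)) * q ≤ (1 + √(1 - L)) * p := by
  have unit : ∀ l : ℝ, Module.End.HasEigenvalue T (l : ℂ) → ∃ v, ‖v‖ = 1 ∧ T v = (l : ℂ) • v := by
    intro l hl
    obtain ⟨v, hv⟩ := hl.exists_hasEigenvector
    have hv0 : ‖v‖ ≠ 0 := norm_ne_zero_iff.2 hv.2
    refine ⟨((‖v‖⁻¹ : ℝ) : ℂ) • v, ?_, ?_⟩
    · rw [norm_smul]; simp [hv0]
    · rw [map_smul, hv.apply_eq_smul, smul_comm]
  obtain ⟨v, hv, hTv⟩ := unit p hp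
  obtain ⟨u, hu, hTu⟩ := unit q hq
  have hvv : (inner ℂ v v).re = 1 := re_inner_self_of_norm_eq_one hv
  have huu : (inner ℂ u u).re = 1 := re_inner_self_of_norm_eq_one hu
  -- Testing with `w = x = v` gives `Lp ≤ p`, and `L < 1`.
  have hp0 : 0 ≤ p := by
    have := h v hv v
    rw [reForm, hTv, inner_smul_right, Complex.re_ofReal_mul, hvv] at this
    nlinarith
  set σ := √(1 - L)
  have hσ : 0 < σ := Real.sqrt_pos.2 (by linarith)
  have hσ2 : σ ^ 2 = 1 - L := Real.sq_sqrt (by linarith)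
  rcases hpq.eq_or_lt with rfl | hlt
  · nlinarith
  have huv : (inner ℂ v u) = 0 := by
    have h1 := hT v u
    rw [hTv, hTu, inner_smul_left, inner_smul_right, Complex.conj_ofReal] at h1
    have h2 : ((p : ℂ) - q) * inner ℂ v u = 0 := by rw [sub_mul, h1, sub_self]
    exact (mul_eq_zero.1 h2).resolve_left (by
      rw [← Complex.ofReal_sub]; exact_mod_cast (sub_neg.2 hlt).ne)
  have hvu : (inner ℂ u v) = 0 := inner_eq_zero_symm.1 huv
  have svv : reForm T v v = p := by
    rw [reForm, hTv, inner_smul_right, Complex.re_ofReal_mul, hvv, mul_one]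
  have suu : reForm T u u = q := by
    rw [reForm, hTu, inner_smul_right, Complex.re_ofReal_mul, huu, mul_one]
  have svu : reForm T v u = 0 := by rw [reForm, hTu, inner_smul_right, huv]; simp
  have suv : reForm T u v = 0 := by rw [reForm, hTv, inner_smul_right, hvu]; simp
  set r : ℝ := √(1 / 2)
  have hr : r ^ 2 = 1 / 2 := Real.sq_sqrt (by norm_num)
  set w : E := (r : ℂ) • v + (r : ℂ) • u
  have hww : ‖w‖ = 1 := by
    have : ‖w‖ ^ 2 = 1 := by
      rw [← @inner_self_eq_norm_sq ℂ]
      change (inner ℂ w w).re = 1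
      simp only [w, inner_add_left, inner_add_right, inner_smul_left, inner_smul_right, huv, hvu,
        Complex.conj_ofReal, Complex.add_re, Complex.re_ofReal_mul, hvv, huu, mul_zero,
        Complex.zero_re]
      nlinarith
    nlinarith [norm_nonneg w]
  -- Equality case of Kantorovich: `w` mixes the extreme eigenvectors equally, and for `p > 0` the
  -- vector `q v + p u` is a multiple of `T⁻¹ w`.
  have hS := h w hww ((q : ℂ) • v + (p : ℂ) • u)
  have h1 : (inner ℂ w ((q : ℂ) • v + (p : ℂ) • u)).re = r * (p + q) := by
    simp only [w, inner_add_left, inner_add_right, inner_smul_left, inner_smul_right, huv, hvu,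
      Complex.conj_ofReal, Complex.add_re, Complex.re_ofReal_mul, hvv, huu, mul_zero,
      Complex.zero_re]
    ring
  have h2 : reForm T w w = (p + q) / 2 := by
    simp only [w, reForm_add_left, reForm_add_right, reForm_smul_left, reForm_smul_right, svv, suu,
      svu, suv]
    linear_combination (p + q) * hr
  have h3 : reForm T ((q : ℂ) • v + (p : ℂ) • u) ((q : ℂ) • v + (p : ℂ) • u) =
      p * q * (p + q) := by
    simp only [reForm_add_left, reForm_add_right, reForm_smul_left, reForm_smul_right, svv, suu,
      svu, suv]
    ring
  rw [h1, h2, h3, mul_pow, hr] at hS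
  have hs : 0 < p + q := by linarith
  have h4 : L * (p + q) ^ 2 ≤ 4 * (p * q) := by
    by_contra hc
    nlinarith [mul_pos (sub_pos.2 (not_le.1 hc)) hs]
  have h5 : (q - p) ^ 2 ≤ (σ * (p + q)) ^ 2 := by
    rw [mul_pow, hσ2]; nlinarith
  have h6 := abs_le_of_sq_le_sq h5 (by positivity)
  nlinarith [(le_abs_self (q - p)).trans h6]

end QuadraticForm

/-! ### Eigenvalues of a real symmetric matrix and of its complexification. -/

section Eigenvalues

variable {m : ℕ}

/-- The operator on `ℂ^m` defined by a real matrix. -/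
noncomputable abbrev complexOp (M : Matrix (Fin m) (Fin m) ℝ) :
    EuclideanSpace ℂ (Fin m) →ₗ[ℂ] EuclideanSpace ℂ (Fin m) :=
  Matrix.toEuclideanLin (M.map Complex.ofReal)

theorem complexOp_isSymmetric {M : Matrix (Fin m) (Fin m) ℝ} (hM : M.IsSymm) :
    (complexOp M).IsSymmetric := by
  rw [Matrix.isSymmetric_toEuclideanLin_iff]
  ext i j
  simp [Matrix.conjTranspose_apply, hM.apply i j]

/-- For real `l` the real and imaginary parts of a complex eigenvector solve the real eigenvalue
equation separately, and one of them is nonzero. -/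
theorem hasEigenvalue_complexOp_iff (M : Matrix (Fin m) (Fin m) ℝ) (l : ℝ) :
    Module.End.HasEigenvalue (complexOp M) (l : ℂ) ↔
      Module.End.HasEigenvalue (Matrix.toLin' M) l := by
  have key : ∀ v : EuclideanSpace ℂ (Fin m), complexOp M v = (l : ℂ) • v ↔
      M.mulVec (fun i => (v i).re) = l • (fun i => (v i).re) ∧
      M.mulVec (fun i => (v i).im) = l • (fun i => (v i).im) := by
    intro v
    rw [PiLp.ext_iff, funext_iff, funext_iff, ← forall_and]
    refine forall_congr' fun i => ?_
    simp [complexOp, Matrix.mulVec, dotProduct, Complex.ext_iff]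
  constructor
  · intro h
    obtain ⟨v, hv⟩ := h.exists_hasEigenvector
    obtain ⟨h1, h2⟩ := (key v).1 hv.apply_eq_smul
    by_cases hz : (fun i => (v i).re) = 0
    · refine Module.End.hasEigenvalue_of_hasEigenvector (x := fun i => (v i).im)
        ⟨Module.End.mem_eigenspace_iff.2 (by simpa using h2), fun hz' => hv.2 ?_⟩
      ext i
      exact Complex.ext (congrFun hz i) (congrFun hz' i)
    · exact Module.End.hasEigenvalue_of_hasEigenvector
        ⟨Module.End.mem_eigenspace_iff.2 (by simpa using h1), hz⟩
  · intro h
    obtain ⟨v, hv⟩ := h.exists_hasEigenvector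
    refine Module.End.hasEigenvalue_of_hasEigenvector
      (x := WithLp.toLp 2 fun i => ((v i : ℝ) : ℂ))
      ⟨Module.End.mem_eigenspace_iff.2 ((key _).2 ⟨?_, ?_⟩), fun hz => hv.2 ?_⟩
    · simpa using hv.apply_eq_smul
    · ext i; simp [Matrix.mulVec, dotProduct]
    · ext i
      have := congrArg (fun z : EuclideanSpace ℂ (Fin m) => z i) hz
      simpa using this

/-- Together with finiteness of the spectrum, this makes the `sInf` and `sSup` in `minEigenvalue`
and `maxEigenvalue` attained. `1 ≤ m` excludes the empty set, where both default to `0`. -/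
theorem exists_hasEigenvalue (hm : 1 ≤ m) {M : Matrix (Fin m) (Fin m) ℝ} (hM : M.IsSymm) :
    {l : ℝ | Module.End.HasEigenvalue (Matrix.toLin' M) l}.Nonempty :=
  ⟨_, (hasEigenvalue_complexOp_iff M _).1
    ((complexOp_isSymmetric hM).hasEigenvalue_eigenvalues finrank_euclideanSpace_fin ⟨0, hm⟩)⟩

theorem finite_setOf_hasEigenvalue (M : Matrix (Fin m) (Fin m) ℝ) :
    {l : ℝ | Module.End.HasEigenvalue (Matrix.toLin' M) l}.Finite :=
  Module.End.finite_hasEigenvalue _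

theorem hasEigenvalue_minEigenvalue (hm : 1 ≤ m) {M : Matrix (Fin m) (Fin m) ℝ} (hM : M.IsSymm) :
    Module.End.HasEigenvalue (Matrix.toLin' M) (minEigenvalue M) :=
  (exists_hasEigenvalue hm hM).csInf_mem (finite_setOf_hasEigenvalue M)

theorem hasEigenvalue_maxEigenvalue (hm : 1 ≤ m) {M : Matrix (Fin m) (Fin m) ℝ} (hM : M.IsSymm) :
    Module.End.HasEigenvalue (Matrix.toLin' M) (maxEigenvalue M) :=
  (exists_hasEigenvalue hm hM).csSup_mem (finite_setOf_hasEigenvalue M)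

theorem mem_Icc_of_hasEigenvalue {M : Matrix (Fin m) (Fin m) ℝ} {l : ℝ}
    (hl : Module.End.HasEigenvalue (Matrix.toLin' M) l) :
    minEigenvalue M ≤ l ∧ l ≤ maxEigenvalue M :=
  ⟨csInf_le (finite_setOf_hasEigenvalue M).bddBelow hl,
    le_csSup (finite_setOf_hasEigenvalue M).bddAbove hl⟩

theorem hasEigenvalue_sub_smul_one_iff (M : Matrix (Fin m) (Fin m) ℝ) (k l : ℝ) :
    Module.End.HasEigenvalue (Matrix.toLin' (M - k • (1 : Matrix (Fin m) (Fin m) ℝ))) l ↔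
      Module.End.HasEigenvalue (Matrix.toLin' M) (l + k) := by
  have : Module.End.eigenspace (Matrix.toLin' (M - k • (1 : Matrix (Fin m) (Fin m) ℝ))) l =
      Module.End.eigenspace (Matrix.toLin' M) (l + k) := by
    ext v
    simp [sub_eq_iff_eq_add, add_smul]
  rw [Module.End.hasEigenvalue_iff, Module.End.hasEigenvalue_iff, this]

/-- In dimension two the extreme eigenvalues are determined by trace and determinant. -/
theorem eigenvalues_fin_two {M : Matrix (Fin 2) (Fin 2) ℝ} (hM : M.IsSymm) (s : ℝ) :
    (1 + s) * minEigenvalue M - (1 - s) * maxEigenvalue M =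
      s * M.trace - √(M.trace ^ 2 - 4 * M.det) := by
  have hroot : ∀ l : ℝ, Module.End.HasEigenvalue (Matrix.toLin' M) l ↔
      l ^ 2 - M.trace * l + M.det = 0 := by
    intro l
    rw [Module.End.hasEigenvalue_iff_isRoot_charpoly, Matrix.charpoly_toLin',
      Matrix.charpoly_fin_two]
    simp
  -- By symmetry the discriminant equals `(M 0 0 - M 1 1)² + 4 (M 0 1)²`.
  have hD : 0 ≤ M.trace ^ 2 - 4 * M.det := by
    have h01 := hM.apply 0 1
    rw [Matrix.trace_fin_two, Matrix.det_fin_two, h01]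
    nlinarith [sq_nonneg (M 0 0 - M 1 1), sq_nonneg (M 0 1)]
  set d := √(M.trace ^ 2 - 4 * M.det)
  have hd2 : d ^ 2 = M.trace ^ 2 - 4 * M.det := Real.sq_sqrt hD
  have hd0 : 0 ≤ d := Real.sqrt_nonneg _
  have hset : ∀ l : ℝ, Module.End.HasEigenvalue (Matrix.toLin' M) l ↔
      l = (M.trace - d) / 2 ∨ l = (M.trace + d) / 2 := by
    intro l
    have e : l ^ 2 - M.trace * l + M.det =
        (l - (M.trace - d) / 2) * (l - (M.trace + d) / 2) := by linear_combination hd2 / 4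
    rw [hroot, e, mul_eq_zero, sub_eq_zero, sub_eq_zero]
  have hmin : minEigenvalue M = (M.trace - d) / 2 := by
    refine le_antisymm (mem_Icc_of_hasEigenvalue ((hset _).2 (Or.inl rfl))).1 ?_
    rcases (hset _).1 (hasEigenvalue_minEigenvalue one_le_two hM) with h | h <;> rw [h]
    linarith
  have hmax : maxEigenvalue M = (M.trace + d) / 2 := by
    refine le_antisymm ?_ (mem_Icc_of_hasEigenvalue ((hset _).2 (Or.inr rfl))).2
    rcases (hset _).1 (hasEigenvalue_maxEigenvalue one_le_two hM) with h | h <;> rw [h]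
    linarith
  rw [hmin, hmax]
  ring

end Eigenvalues

/-! ### Consequences of admissibility of `φ`, and the supremum `Λ_∞²`. -/

namespace IsAdmissible

variable {φ : ℝ → ℝ} (h : IsAdmissible φ)
include h

theorem contDiffAt {s : ℝ} (hs : 0 < s) : ContDiffAt ℝ 1 φ s :=
  h.contDiffOn.contDiffAt (Ioi_mem_nhds hs)

theorem hasDerivAt {s : ℝ} (hs : 0 < s) : HasDerivAt φ (deriv φ s) s :=
  ((h.contDiffAt hs).differentiableAt one_ne_zero).hasDerivAt

theorem continuousOn_deriv : ContinuousOn (deriv φ) (Ioi 0) :=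
  h.contDiffOn.continuousOn_deriv_of_isOpen isOpen_Ioi le_rfl

theorem hasDerivAt_id_mul {s : ℝ} (hs : 0 < s) :
    HasDerivAt (fun t => t * φ t) (φ s + s * deriv φ s) s := by
  simpa using! (hasDerivAt_id s).mul (h.hasDerivAt hs)

theorem add_mul_deriv_pos {s : ℝ} (hs : 0 < s) : 0 < φ s + s * deriv φ s := by
  rw [← (h.hasDerivAt_id_mul hs).deriv]
  exact h.deriv_pos s hs

theorem neg_one_lt {s : ℝ} (hs : 0 < s) : -1 < s * deriv φ s / φ s := by
  rw [lt_div_iff₀ (h.pos s hs)]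
  linarith [h.add_mul_deriv_pos hs]

theorem lambdaRatio_eq {s : ℝ} (hs : 0 < s) :
    lambdaRatio φ s = -((s * deriv φ s / φ s) / (s * deriv φ s / φ s + 2)) := by
  have := (h.pos s hs).ne'
  have h2 := h.add_mul_deriv_pos hs
  have h3 : s * deriv φ s + 2 * φ s ≠ 0 := by linarith [h.pos s hs]
  rw [lambdaRatio, div_add' _ _ _ this, div_div_div_cancel_right₀ this]

/-- `|sφ'| < sφ' + 2φ` amounts to `φ + sφ' > 0`, i.e. to `(sφ)' > 0`. -/
theorem lambdaRatio_sq_lt_one {s : ℝ} (hs : 0 < s) : lambdaRatio φ s ^ 2 < 1 := by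
  have h1 := h.pos s hs
  have h2 := h.add_mul_deriv_pos hs
  have h3 : 0 < s * deriv φ s + 2 * φ s := by linarith
  rw [lambdaRatio, neg_sq, div_pow, div_lt_one (by positivity)]
  nlinarith

theorem strictMonoOn_id_mul : StrictMonoOn (fun s => s * φ s) (Ioi 0) := by
  refine strictMonoOn_of_deriv_pos (convex_Ioi 0)
    (continuousOn_id.mul h.contDiffOn.continuousOn) fun x hx => ?_
  rw [interior_Ioi] at hx
  exact h.deriv_pos x hx

/-- Surjectivity of `s ↦ s√φ(s)` turns the supremum over `t` into one over `s`. As `(s√φ(s))² = s ·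
sφ(s)`, choose `a` with `aφ(a) = t`: at `min a t` both factors are at most `t`, at `max a t` both
are at least `t`, and the intermediate value theorem applies. -/
theorem exists_mul_sqrt_eq {t : ℝ} (ht : 0 < t) : ∃ s, 0 < s ∧ s * √(φ s) = t := by
  obtain ⟨a, ha, hat⟩ : t ∈ (fun s => s * φ s) '' Ioi 0 := by rw [h.range_eq]; exact ht
  have ha0 : 0 < a := ha
  have hat' : a * φ a = t := hat
  have hlo : 0 < min a t := lt_min ha0 ht
  have hcont : ContinuousOn (fun s => s * (s * φ s)) (Icc (min a t) (max a t)) :=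
    (continuousOn_id.mul (continuousOn_id.mul h.contDiffOn.continuousOn)).mono fun x hx =>
      hlo.trans_le hx.1
  have hm := h.strictMonoOn_id_mul.monotoneOn
  have h1 : min a t * (min a t * φ (min a t)) ≤ t * t := by
    have : min a t * φ (min a t) ≤ t := (hm hlo ha (min_le_left _ _)).trans_eq hat'
    exact mul_le_mul (min_le_right _ _) this (mul_pos hlo (h.pos _ hlo)).le ht.le
  have h2 : t * t ≤ max a t * (max a t * φ (max a t)) := by
    have hmx : 0 < max a t := ht.trans_le (le_max_right _ _)
    have : t ≤ max a t * φ (max a t) := hat'.symm.trans_le (hm ha hmx (le_max_left _ _))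
    exact mul_le_mul (le_max_right _ _) this ht.le hmx.le
  obtain ⟨s, hs, hst⟩ := intermediate_value_Icc min_le_max hcont ⟨h1, h2⟩
  have hs0 : 0 < s := hlo.trans_le hs.1
  refine ⟨s, hs0, ?_⟩
  have hst' : s * (s * φ s) = t * t := hst
  have : (s * √(φ s)) ^ 2 = t ^ 2 := by
    rw [mul_pow, Real.sq_sqrt (h.pos s hs0).le]; linarith
  exact (sq_eq_sq₀ (by positivity) ht.le).1 this

theorem lambdaRatio_sq_le {s : ℝ} (hs : 0 < s) : lambdaRatio φ s ^ 2 ≤ LambdaInftySq φ := by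
  -- Without boundedness the real `⨆` would default to `0`.
  have hb : BddAbove (range fun t : Ioi (0 : ℝ) => Lambda φ t ^ 2) := by
    refine ⟨1, ?_⟩
    rintro _ ⟨⟨t, ht⟩, rfl⟩
    obtain ⟨s, hs, rfl⟩ := h.exists_mul_sqrt_eq ht
    change Lambda φ (s * √(φ s)) ^ 2 ≤ 1
    rw [Lambda_apply h hs]
    exact (h.lambdaRatio_sq_lt_one hs).le
  have := le_ciSup hb ⟨s * √(φ s), mul_pos hs (Real.sqrt_pos.2 (h.pos s hs))⟩
  simp only [Lambda_apply h hs] at this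
  exact this

theorem LambdaInftySq_mul_le {c d : ℝ} (hc : 0 ≤ c)
    (hd : ∀ s, 0 < s → lambdaRatio φ s ^ 2 * c ≤ d) : LambdaInftySq φ * c ≤ d := by
  have : Nonempty (Ioi (0 : ℝ)) := ⟨⟨1, mem_Ioi.2 one_pos⟩⟩
  rw [LambdaInftySq, Real.iSup_mul_of_nonneg hc]
  refine ciSup_le ?_
  rintro ⟨t, ht⟩
  obtain ⟨s, hs, rfl⟩ := h.exists_mul_sqrt_eq ht
  simp only [Lambda_apply h hs]
  exact hd s hs

theorem LambdaInftySq_nonneg : 0 ≤ LambdaInftySq φ :=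
  (sq_nonneg _).trans (h.lambdaRatio_sq_le one_pos)

theorem tendsto_id_mul_zero : Tendsto (fun s => s * φ s) (𝓝[>] 0) (𝓝 0) := by
  rw [Metric.tendsto_nhds]
  intro ε hε
  obtain ⟨a, ha, hat⟩ : ε ∈ (fun s => s * φ s) '' Ioi 0 := by rw [h.range_eq]; exact hε
  filter_upwards [Ioo_mem_nhdsGT ha] with s hs
  have h1 := h.strictMonoOn_id_mul hs.1 ha hs.2
  have h2 := mul_pos hs.1 (h.pos s hs.1)
  rw [Real.dist_eq, sub_zero, abs_of_pos h2]
  exact h1.trans_eq hat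

/-- A high power of a nonnegative `C¹` cutoff stays `C¹` after composition with `s ↦ s φ(s)`. -/
theorem exists_contDiff_pow {s : ℝ} (hs : 0 < s) : ∃ k : ℕ, k ≠ 0 ∧
    ContDiff ℝ 1 (fun y : ℝ => (s * (max y 0) ^ k) * φ (s * (max y 0) ^ k)) := by
  obtain ⟨C₁, C₂, r, s₀, hC₁, hC₂, hr, hs₀, hgr, -⟩ := h.growth
  -- Near `0⁺` the chain rule and `(sφ)' ≤ C₂ s^r` bound the derivative by a multiple of `y^(kr + k
  -- - 1)`; this choice of `k` makes the exponent positive, which is possible because `r > -1`.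
  obtain ⟨k, hk⟩ := exists_nat_gt (1 / (r + 1))
  have hr1 : 0 < r + 1 := by linarith
  have hk0 : (0 : ℝ) < k := (by positivity : 0 < 1 / (r + 1)).trans hk
  have hkn : k ≠ 0 := by exact_mod_cast hk0.ne'
  have hexp : 0 < k * r + (k - 1) := by
    rw [div_lt_iff₀ hr1] at hk; linarith
  refine ⟨k, hkn, ?_⟩
  set P : ℝ → ℝ := fun y => (s * (max y 0) ^ k) * φ (s * (max y 0) ^ k) with hP
  set Q : ℝ → ℝ := fun y => if y ≤ 0 then 0 else
    (φ (s * y ^ k) + s * y ^ k * deriv φ (s * y ^ k)) * (s * (k * y ^ (k - 1))) with hQ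
  have hPneg : ∀ y ≤ 0, P y = 0 := fun y hy => by simp [hP, max_eq_right hy, hkn]
  have hPpos : ∀ y, 0 < y → P y = (s * y ^ k) * φ (s * y ^ k) := fun y hy => by
    simp [hP, max_eq_left hy.le]
  have hder : ∀ y, y ≠ 0 → HasDerivAt P (Q y) y := by
    intro y hy
    rcases hy.lt_or_gt with hy | hy
    · have : Q y = 0 := if_pos hy.le
      rw [this]
      exact (hasDerivAt_const y (0 : ℝ)).congr_of_eventuallyEq
        (mem_of_superset (Iio_mem_nhds hy) fun z hz => hPneg z (le_of_lt hz))
    · have e : Q y = (φ (s * y ^ k) + s * y ^ k * deriv φ (s * y ^ k)) *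
          (s * (k * y ^ (k - 1))) := if_neg hy.not_ge
      rw [e]
      have h1 : HasDerivAt (fun z : ℝ => s * z ^ k) (s * (k * y ^ (k - 1))) y :=
        (hasDerivAt_pow k y).const_mul s
      have hpos : 0 < s * y ^ k := by positivity
      have h2 : HasDerivAt (fun z : ℝ => s * z ^ k * φ (s * z ^ k)) _ y :=
        HasDerivAt.comp (h := fun z : ℝ => s * z ^ k) y (h.hasDerivAt_id_mul hpos) h1
      exact h2.congr_of_eventuallyEq
        (mem_of_superset (Ioi_mem_nhds hy) fun z hz => hPpos z hz)
  have hzero : Tendsto (fun y : ℝ => s * y ^ k) (𝓝[>] 0) (𝓝[>] 0) := by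
    refine tendsto_nhdsWithin_iff.2 ⟨?_, ?_⟩
    · have : Tendsto (fun y : ℝ => s * y ^ k) (𝓝 0) (𝓝 (s * 0 ^ k)) :=
        (continuous_const.mul (continuous_pow k)).tendsto 0
      rw [zero_pow hkn, mul_zero] at this
      exact this.mono_left nhdsWithin_le_nhds
    · filter_upwards [self_mem_nhdsWithin] with y hy
      have : 0 < y := hy
      exact mem_Ioi.2 (by positivity)
  have glue : ∀ f : ℝ → ℝ, (∀ y ≤ 0, f y = 0) → Tendsto f (𝓝[>] 0) (𝓝 0) →
      ContinuousAt f 0 := by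
    intro f hf hf'
    refine continuousAt_iff_continuous_left'_right'.2 ⟨?_, ?_⟩
    · rw [ContinuousWithinAt, hf 0 le_rfl]
      exact tendsto_const_nhds.congr' (eventually_nhdsWithin_of_forall fun y hy =>
        (hf y (le_of_lt hy)).symm)
    · rwa [ContinuousWithinAt, hf 0 le_rfl]
  have hPc : ContinuousAt P 0 := by
    refine glue P hPneg ((h.tendsto_id_mul_zero.comp hzero).congr' ?_)
    filter_upwards [self_mem_nhdsWithin] with y hy
    exact (hPpos y hy).symm
  have hQc : ContinuousAt Q 0 := by
    refine glue Q (fun y hy => if_pos hy) ?_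
    have hlim : Tendsto (fun y : ℝ => C₂ * s ^ r * (s * k) * y ^ ((k : ℝ) * r + (k - 1)))
        (𝓝[>] 0) (𝓝 0) := by
      have : Tendsto (fun y : ℝ => y ^ ((k : ℝ) * r + (k - 1))) (𝓝 0) (𝓝 0) := by
        have := (Real.continuousAt_rpow_const 0 _ (Or.inr hexp.le)).tendsto
        rwa [Real.zero_rpow hexp.ne'] at this
      simpa using (this.mono_left nhdsWithin_le_nhds).const_mul (C₂ * s ^ r * (s * k))
    refine tendsto_of_tendsto_of_tendsto_of_le_of_le' tendsto_const_nhds hlim ?_ ?_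
    · filter_upwards [self_mem_nhdsWithin] with y hy
      have hy : 0 < y := hy
      rw [hQ]
      simp only [not_le.2 hy, if_false]
      have := h.add_mul_deriv_pos (by positivity : 0 < s * y ^ k)
      positivity
    · filter_upwards [self_mem_nhdsWithin, hzero (Ioo_mem_nhdsGT hs₀)] with y hy hys
      have hy : 0 < y := hy
      have hys : s * y ^ k ∈ Ioo 0 s₀ := hys
      have h1 := (hgr _ hys).2
      rw [(h.hasDerivAt_id_mul hys.1).deriv] at h1
      rw [hQ]
      simp only [not_le.2 hy, if_false]
      calc _ ≤ C₂ * (s * y ^ k) ^ r * (s * (k * y ^ (k - 1))) := by gcongr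
        _ = C₂ * s ^ r * (s * k) * (y ^ ((k : ℝ) * r) * y ^ ((k : ℝ) - 1)) := by
          rw [Real.mul_rpow hs.le (by positivity), ← Real.rpow_natCast, ← Real.rpow_mul hy.le,
            ← Real.rpow_natCast, Nat.cast_sub (Nat.one_le_iff_ne_zero.2 hkn), Nat.cast_one]
          ring
        _ = _ := by rw [← Real.rpow_add hy]
  have hder' : ∀ y, HasDerivAt P (Q y) y := by
    intro y
    rcases eq_or_ne y 0 with rfl | hy
    · exact hasDerivAt_of_hasDerivAt_of_ne hder hPc hQc
    · exact hder y hy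
  have hQcont : Continuous Q := by
    rw [continuous_iff_continuousAt]
    intro y
    rcases lt_trichotomy y 0 with hy | rfl | hy
    · exact continuousAt_const.congr (f := fun _ => (0 : ℝ))
        (mem_of_superset (Iio_mem_nhds hy) fun z hz => (if_pos (le_of_lt hz)).symm)
    · exact hQc
    · have hpos : 0 < s * y ^ k := by positivity
      have c1 : ContinuousAt (fun z : ℝ => s * z ^ k) y := by fun_prop
      have c2 : ContinuousAt (fun z : ℝ => φ (s * z ^ k)) y :=
        ContinuousAt.comp (f := fun z : ℝ => s * z ^ k) (h.contDiffAt hpos).continuousAt c1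
      have c3 : ContinuousAt (fun z : ℝ => deriv φ (s * z ^ k)) y :=
        ContinuousAt.comp (f := fun z : ℝ => s * z ^ k)
          (h.continuousOn_deriv.continuousAt (Ioi_mem_nhds hpos)) c1
      have c4 : ContinuousAt (fun z : ℝ => s * (k * z ^ (k - 1))) y := by fun_prop
      exact ((c2.add (c1.mul c3)).mul c4).congr
        (mem_of_superset (Ioi_mem_nhds hy) fun z hz => (if_neg (not_le.2 hz)).symm)
  rw [contDiff_one_iff_deriv]
  refine ⟨fun y => (hder' y).differentiableAt, ?_⟩
  rwa [show deriv P = Q from funext fun y => (hder' y).deriv]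

end IsAdmissible

/-! ### Differentiating `φ(|u|)u` and the pointwise form of dissipativity. -/

variable {m : ℕ}

/-- The derivative of `y ↦ φ(|y|) y` at `y ≠ 0` in the direction `v`. -/
noncomputable def nlDeriv (φ : ℝ → ℝ) (y v : EuclideanSpace ℂ (Fin m)) :
    EuclideanSpace ℂ (Fin m) :=
  φ ‖y‖ • v + (deriv φ ‖y‖ / ‖y‖ * (inner ℂ y v).re) • y

theorem hasDerivAt_norm_complex {E : Type*} [NormedAddCommGroup E] [InnerProductSpace ℂ E]
    [NormedSpace ℝ E] [IsScalarTower ℝ ℂ E] {u : ℝ → E} {v : E} {x : ℝ}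
    (hu : HasDerivAt u v x) (hx : u x ≠ 0) :
    HasDerivAt (fun y => ‖u y‖) ((inner ℂ (u x) v).re / ‖u x‖) x := by
  have h1 := Complex.reCLM.hasFDerivAt.comp_hasDerivAt x (hu.inner ℂ hu)
  have hn : ∀ z : E, (inner ℂ z z).re = ‖z‖ ^ 2 := fun z => by
    rw [← @inner_self_eq_norm_sq ℂ]; rfl
  have h2 : HasDerivAt (fun y => √(‖u y‖ ^ 2))
      ((inner ℂ (u x) v + inner ℂ v (u x)).re / (2 * √(‖u x‖ ^ 2))) x := by
    refine HasDerivAt.sqrt (f := fun y => ‖u y‖ ^ 2) ?_ (by simpa using hx)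
    refine h1.congr_of_eventuallyEq (Eventually.of_forall fun y => ?_)
    exact (hn (u y)).symm
  simp only [Real.sqrt_sq (norm_nonneg _)] at h2
  convert h2 using 1
  have : ‖u x‖ ≠ 0 := norm_ne_zero_iff.2 hx
  rw [Complex.add_re, re_inner_comm v (u x)]
  field_simp
  ring

theorem IsAdmissible.hasDerivAt_smul {φ : ℝ → ℝ} (h : IsAdmissible φ)
    {u : ℝ → EuclideanSpace ℂ (Fin m)} {v : EuclideanSpace ℂ (Fin m)} {x : ℝ}
    (hu : HasDerivAt u v x) (hx : u x ≠ 0) :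
    HasDerivAt (fun y => φ ‖u y‖ • u y) (nlDeriv φ (u x) v) x := by
  have hn : 0 < ‖u x‖ := norm_pos_iff.2 hx
  have h1 : HasDerivAt (fun y => φ ‖u y‖) (deriv φ ‖u x‖ * ((inner ℂ (u x) v).re / ‖u x‖)) x :=
    (h.hasDerivAt hn).comp x (hasDerivAt_norm_complex hu hx)
  refine (h1.smul hu).congr_deriv ?_
  unfold nlDeriv
  congr 2
  ring

/-- Normalizing `y` and factoring out `φ(|y|)` produces the form treated by
`forall_reForm_nonneg_iff`, with `g = sφ'(s)/φ(s)` and `s = |y|`. -/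
theorem re_inner_nlDeriv {φ : ℝ → ℝ} (h : IsAdmissible φ) {y : EuclideanSpace ℂ (Fin m)}
    (hy : y ≠ 0) (v : EuclideanSpace ℂ (Fin m))
    (T : EuclideanSpace ℂ (Fin m) →ₗ[ℂ] EuclideanSpace ℂ (Fin m)) :
    (inner ℂ (nlDeriv φ y v) (T v)).re = φ ‖y‖ * (reForm T v v +
      (‖y‖ * deriv φ ‖y‖ / φ ‖y‖) * (inner ℂ (((‖y‖⁻¹ : ℝ) : ℂ) • y) v).re *
        reForm T (((‖y‖⁻¹ : ℝ) : ℂ) • y) v) := by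
  have hn : 0 < ‖y‖ := norm_pos_iff.2 hy
  have hφ := (h.pos _ hn).ne'
  rw [reForm_smul_left, inner_smul_left, Complex.conj_ofReal, Complex.re_ofReal_mul, nlDeriv,
    ← Complex.coe_smul, ← Complex.coe_smul, inner_add_left, inner_smul_left, inner_smul_left,
    Complex.conj_ofReal, Complex.conj_ofReal, Complex.add_re, Complex.re_ofReal_mul,
    Complex.re_ofReal_mul]
  change φ ‖y‖ * reForm T v v + _ * reForm T y v = _
  field_simp

/-- The pointwise condition equivalent to dissipativity. -/
def PointwiseDissipative (L : ℝ) (T : EuclideanSpace ℂ (Fin m) →ₗ[ℂ] EuclideanSpace ℂ (Fin m)) :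
    Prop :=
  ∀ w, ‖w‖ = 1 → ∀ x, L * (inner ℂ w x).re ^ 2 * reForm T w w ≤ reForm T x x

theorem norm_inv_norm_smul {y : EuclideanSpace ℂ (Fin m)} (hy : y ≠ 0) :
    ‖((‖y‖⁻¹ : ℝ) : ℂ) • y‖ = 1 := by
  have : ‖y‖ ≠ 0 := norm_ne_zero_iff.2 hy
  rw [norm_smul]; simp [this]

theorem pointwiseDissipative_of_forall {φ : ℝ → ℝ} (h : IsAdmissible φ)
    {T : EuclideanSpace ℂ (Fin m) →ₗ[ℂ] EuclideanSpace ℂ (Fin m)} (hT : T.IsSymmetric)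
    (H : ∀ y, y ≠ 0 → ∀ v, 0 ≤ (inner ℂ (nlDeriv φ y v) (T v)).re) :
    PointwiseDissipative (LambdaInftySq φ) T := by
  have key : ∀ s, 0 < s → ∀ w, ‖w‖ = 1 → ∀ x,
      lambdaRatio φ s ^ 2 * (inner ℂ w x).re ^ 2 * reForm T w w ≤ reForm T x x := by
    intro s hs w hw
    rw [h.lambdaRatio_eq hs]
    rw [← forall_reForm_nonneg_iff hT hw (h.neg_one_lt hs)]
    -- Every pair `(s, w)` is realized by the vector `y = s w`.
    intro x
    have hns : ‖((s : ℝ) : ℂ) • w‖ = s := by rw [norm_smul, hw]; simp [hs.le]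
    have h0 : ((s : ℝ) : ℂ) • w ≠ 0 := by rw [← norm_ne_zero_iff, hns]; exact hs.ne'
    have h1 := H _ h0 x
    rw [re_inner_nlDeriv h h0, hns, smul_smul, ← Complex.ofReal_mul, inv_mul_cancel₀ hs.ne',
      Complex.ofReal_one, one_smul] at h1
    exact nonneg_of_mul_nonneg_right h1 (h.pos s hs)
  intro w hw x
  rcases le_or_gt 0 (reForm T w w) with h0 | h0
  · rw [mul_assoc]
    refine h.LambdaInftySq_mul_le (by positivity) fun s hs => ?_
    rw [← mul_assoc]
    exact key s hs w hw x
  -- A negative `S(w, w)` is impossible: `x = w` would give `λ² S(w, w) ≤ S(w, w)` with `λ² < 1`.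
  · have h1 := key 1 one_pos w hw w
    rw [re_inner_self_of_norm_eq_one hw] at h1
    nlinarith [h.lambdaRatio_sq_lt_one one_pos]

/-- Replacing `Λ_∞²` by the smaller `λ(s)²` weakens the inequality only because `S(w, w) ≥ 0`; this
is the role of `hpos`. -/
theorem PointwiseDissipative.re_inner_nonneg {φ : ℝ → ℝ} (h : IsAdmissible φ)
    {T : EuclideanSpace ℂ (Fin m) →ₗ[ℂ] EuclideanSpace ℂ (Fin m)} (hT : T.IsSymmetric)
    (H : PointwiseDissipative (LambdaInftySq φ) T) (hpos : ∀ x, 0 ≤ reForm T x x)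
    {y : EuclideanSpace ℂ (Fin m)} (hy : y ≠ 0) (v : EuclideanSpace ℂ (Fin m)) :
    0 ≤ (inner ℂ (nlDeriv φ y v) (T v)).re := by
  have hn : 0 < ‖y‖ := norm_pos_iff.2 hy
  have hw := norm_inv_norm_smul hy
  rw [re_inner_nlDeriv h hy]
  refine mul_nonneg (h.pos _ hn).le ?_
  revert v
  rw [forall_reForm_nonneg_iff hT hw (h.neg_one_lt hn)]
  intro z
  rw [← h.lambdaRatio_eq hn]
  refine le_trans ?_ (H _ hw z)
  gcongr
  · exact hpos _
  · exact h.lambdaRatio_sq_le hn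

/-- At a zero of `u` the integrand of a positive semidefinite operator is nonnegative. -/
theorem IsAdmissible.re_inner_nonneg_of_eq_zero {φ : ℝ → ℝ} (h : IsAdmissible φ)
    {u : ℝ → EuclideanSpace ℂ (Fin m)} {v d : EuclideanSpace ℂ (Fin m)} {x : ℝ}
    (hu : HasDerivAt u v x) (hw : HasDerivAt (fun y => φ ‖u y‖ • u y) d x) (hx : u x = 0)
    {z : EuclideanSpace ℂ (Fin m)} (hz : 0 < (inner ℂ v z).re) :
    0 ≤ (inner ℂ d z).re := by
  have c : Continuous fun y : EuclideanSpace ℂ (Fin m) => (inner ℂ y z).re := by fun_prop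
  have h1 := (c.tendsto _).comp hu.tendsto_slope
  have h2 := (c.tendsto _).comp hw.tendsto_slope
  refine ge_of_tendsto h2 ?_
  filter_upwards [h1.eventually (lt_mem_nhds hz)] with y hy
  -- As `u x = 0`, the difference quotient of `φ(|u|)u` is a scalar `φ(|u y|)` times that of `u`, so
  -- the sign of the inner product is inherited in the limit even if `φ` is singular at `0`.
  have hs : slope (fun y => φ ‖u y‖ • u y) x y = ((φ ‖u y‖ : ℝ) : ℂ) • slope u x y := by
    simp only [slope_def_module, hx, sub_zero, smul_zero]
    rw [smul_comm, Complex.coe_smul]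
  have hpos : 0 < ‖u y‖ := by
    rw [norm_pos_iff]
    intro h0
    simp [slope_def_module, hx, h0] at hy
  change 0 ≤ (inner ℂ (slope (fun y => φ ‖u y‖ • u y) x y) z).re
  rw [hs, inner_smul_left, Complex.conj_ofReal, Complex.re_ofReal_mul]
  exact mul_nonneg (h.pos _ hpos).le (le_of_lt hy)

theorem isOpen_openInterval (a b : EReal) : IsOpen (openInterval a b) :=
  isOpen_Ioo.preimage continuous_coe_real_ereal

/-- Integrability of the density of the dissipativity form. -/
theorem integrable_inner_complexOp {I : Set ℝ} {M : ℝ → Matrix (Fin m) (Fin m) ℝ}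
    (hM : ∀ i j, LocallyIntegrableOn (fun x => M x i j) I volume)
    {p q : ℝ → EuclideanSpace ℂ (Fin m)} (hp : Continuous p) (hq : Continuous q)
    (hqc : HasCompactSupport q) (hqI : tsupport q ⊆ I) :
    Integrable (fun x => inner ℂ (p x) (complexOp (M x) (q x))) volume := by
  have hsupp : Function.support (fun x => inner ℂ (p x) (complexOp (M x) (q x))) ⊆ tsupport q := by
    intro x hx
    by_contra hxq
    apply hx
    simp [image_eq_zero_of_notMem_tsupport hxq]
  rw [← integrableOn_iff_integrable_of_support_subset hsupp]
  have e : (fun x => inner ℂ (p x) (complexOp (M x) (q x))) =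
      fun x => ∑ i, ∑ j, (M x i j : ℂ) * (q x j * (starRingEnd ℂ) (p x i)) := by
    ext x
    rw [PiLp.inner_apply]
    refine Finset.sum_congr rfl fun i _ => ?_
    simp only [complexOp, Matrix.ofLp_toLpLin, Matrix.toLin'_apply, Matrix.mulVec, dotProduct,
      Matrix.map_apply, RCLike.inner_apply, Finset.sum_mul, mul_assoc]
  rw [e]
  refine integrable_finsetSum _ fun i _ => integrable_finsetSum _ fun j _ => ?_
  have h1 : IntegrableOn (fun x => (M x i j : ℂ)) (tsupport q) volume :=
    ((hM i j).integrableOn_compact_subset hqI hqc).ofReal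
  refine h1.mul_continuousOn (Continuous.continuousOn ?_) hqc
  have cp : Continuous fun x => p x i := (EuclideanSpace.proj (𝕜 := ℂ) i).continuous.comp hp
  have cq : Continuous fun x => q x j := (EuclideanSpace.proj (𝕜 := ℂ) j).continuous.comp hq
  exact cq.mul (Complex.continuous_conj.comp cp)

/-! ### Lebesgue points of the coefficients. -/

/-- `x` is a Lebesgue point of `a`. -/
def IsLebesguePoint (a : ℝ → ℝ) (x : ℝ) : Prop :=
  Tendsto (fun ε => ε⁻¹ * ∫ y in Metric.closedBall x ε, |a y - a x|) (𝓝[>] 0) (𝓝 0)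

theorem ae_isLebesguePoint_of_integrable {a : ℝ → ℝ} (ha : Integrable a) :
    ∀ᵐ x, IsLebesguePoint a x := by
  filter_upwards [IsUnifLocDoublingMeasure.ae_tendsto_average_norm_sub volume
    ha.locallyIntegrable 1] with x hx
  have h1 := hx (fun _ : ℝ => x) (fun ε => ε) (l := 𝓝[>] 0) tendsto_id (by
    filter_upwards [self_mem_nhdsWithin] with ε hε
    rw [one_mul]
    exact Metric.mem_closedBall_self (le_of_lt hε))
  -- The average divides by the length `2ε`, `IsLebesguePoint` by `ε`.
  have h2 := h1.const_mul 2
  rw [mul_zero] at h2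
  refine h2.congr' ?_
  filter_upwards [self_mem_nhdsWithin] with ε hε
  have hε : 0 < ε := hε
  rw [setAverage_eq, Measure.real, Real.volume_closedBall, ENNReal.toReal_ofReal (by positivity),
    smul_eq_mul]
  simp only [Real.norm_eq_abs]
  field_simp

/-- Being a Lebesgue point is a local property: near each point of `I` the function may be cut off
to a compact ball, where it is integrable. -/
theorem ae_isLebesguePoint {I : Set ℝ} (hI : IsOpen I) {a : ℝ → ℝ}
    (ha : LocallyIntegrableOn a I volume) :
    ∀ᵐ x ∂(volume.restrict I), IsLebesguePoint a x := by
  rw [ae_restrict_iff' hI.measurableSet, ae_iff]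
  refine measure_null_of_locally_null _ fun x hx => ?_
  obtain ⟨hxI, -⟩ : x ∈ I ∧ ¬ IsLebesguePoint a x := by simpa using hx
  obtain ⟨R, hR, hRI⟩ := Metric.nhds_basis_closedBall.mem_iff.1 (hI.mem_nhds hxI)
  have hint : Integrable ((Metric.closedBall x R).indicator a) :=
    (ha.integrableOn_compact_subset hRI (isCompact_closedBall x R)).integrable_indicator
      Metric.isClosed_closedBall.measurableSet
  have hae := ae_isLebesguePoint_of_integrable hint
  refine ⟨Metric.ball x R ∩ {y | ¬ (y ∈ I → IsLebesguePoint a y)},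
    inter_mem (mem_nhdsWithin_of_mem_nhds (Metric.ball_mem_nhds x hR)) self_mem_nhdsWithin,
    measure_mono_null ?_ (ae_iff.1 hae)⟩
  rintro y ⟨hyR, hy⟩ hy'
  refine hy fun _ => hy'.congr' ?_
  obtain ⟨r, hr, hrR⟩ := Metric.nhds_basis_closedBall.mem_iff.1
    (Metric.isOpen_ball.mem_nhds hyR)
  filter_upwards [Ioo_mem_nhdsGT hr] with ε hε
  congr 1
  refine setIntegral_congr_fun Metric.isClosed_closedBall.measurableSet fun z hz => ?_
  have hz' : z ∈ Metric.closedBall x R := Metric.ball_subset_closedBall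
    (hrR (Metric.closedBall_subset_closedBall hε.2.le hz))
  simp only [indicator_of_mem hz', indicator_of_mem (Metric.ball_subset_closedBall hyR)]

/-! ### Test fields and localization of the dissipativity inequality. -/

theorem isC1c_of_eq_zero {I K : Set ℝ} (hK : IsCompact K) (hKI : K ⊆ I)
    {w : ℝ → EuclideanSpace ℂ (Fin m)} (hw : ContDiff ℝ 1 w) (h0 : ∀ x, x ∉ K → w x = 0) :
    IsC1c I w := by
  refine ⟨hw, HasCompactSupport.intro hK h0, Subset.trans ?_ hKI⟩
  refine closure_minimal (fun x hx => ?_) hK.isClosed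
  by_contra hxK
  exact hx (h0 x hxK)

theorem IsC1c.continuous_deriv {I : Set ℝ} {u : ℝ → EuclideanSpace ℂ (Fin m)} (hu : IsC1c I u) :
    Continuous (deriv u) :=
  hu.1.continuous_deriv le_rfl

theorem IsC1c.hasDerivAt {I : Set ℝ} {u : ℝ → EuclideanSpace ℂ (Fin m)} (hu : IsC1c I u) (x : ℝ) :
    HasDerivAt u (deriv u x) x :=
  (hu.1.differentiable one_ne_zero x).hasDerivAt

theorem IsC1c.integrable_inner {I : Set ℝ} {M : ℝ → Matrix (Fin m) (Fin m) ℝ}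
    (hM : ∀ i j, LocallyIntegrableOn (fun x => M x i j) I volume)
    {w u : ℝ → EuclideanSpace ℂ (Fin m)} (hw : IsC1c I w) (hu : IsC1c I u) :
    Integrable (fun x => inner ℂ (deriv w x) (complexOp (M x) (deriv u x))) volume :=
  integrable_inner_complexOp hM hw.continuous_deriv hu.continuous_deriv hu.2.1.deriv
    (tsupport_deriv_subset.trans hu.2.2)

theorem IsC1c.setIntegral_inner {I : Set ℝ} (M : ℝ → Matrix (Fin m) (Fin m) ℝ)
    {w u : ℝ → EuclideanSpace ℂ (Fin m)} (hu : IsC1c I u) :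
    (∫ x in I, inner ℂ (deriv w x) (complexOp (M x) (deriv u x))) =
      ∫ x, inner ℂ (deriv w x) (complexOp (M x) (deriv u x)) := by
  refine setIntegral_eq_integral_of_forall_compl_eq_zero fun x hx => ?_
  have : deriv u x = 0 :=
    image_eq_zero_of_notMem_tsupport fun h => hx (hu.2.2 (tsupport_deriv_subset h))
  rw [this, map_zero, inner_zero_right]

theorem nlDeriv_smul (φ : ℝ → ℝ) (y v : EuclideanSpace ℂ (Fin m)) (c : ℝ) :
    nlDeriv φ y (c • v) = c • nlDeriv φ y v := by
  unfold nlDeriv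
  rw [← Complex.coe_smul c v, inner_smul_right, Complex.re_ofReal_mul, Complex.coe_smul, smul_add]
  congr 1
  · exact smul_comm _ _ _
  · rw [smul_smul]
    congr 1
    ring

theorem IsAdmissible.continuousAt_nlDeriv {φ : ℝ → ℝ} (h : IsAdmissible φ)
    {y : EuclideanSpace ℂ (Fin m)} (hy : y ≠ 0) (v : EuclideanSpace ℂ (Fin m)) :
    ContinuousAt (fun z => nlDeriv φ z v) y := by
  have hn : 0 < ‖y‖ := norm_pos_iff.2 hy
  have c1 : ContinuousAt (fun z : EuclideanSpace ℂ (Fin m) => φ ‖z‖) y :=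
    ContinuousAt.comp (f := fun z : EuclideanSpace ℂ (Fin m) => ‖z‖)
      (h.contDiffAt hn).continuousAt continuous_norm.continuousAt
  have c2 : ContinuousAt (fun z : EuclideanSpace ℂ (Fin m) => deriv φ ‖z‖) y :=
    ContinuousAt.comp (f := fun z : EuclideanSpace ℂ (Fin m) => ‖z‖)
      (h.continuousOn_deriv.continuousAt (Ioi_mem_nhds hn)) continuous_norm.continuousAt
  have c3 : ContinuousAt (fun z : EuclideanSpace ℂ (Fin m) => (inner ℂ z v).re) y := by fun_prop
  exact (c1.smul continuousAt_const).add
    (((c2.div continuous_norm.continuousAt hn.ne').mul c3).smul continuousAt_id)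

theorem norm_complexOp_sub_le (M N : Matrix (Fin m) (Fin m) ℝ) (v : EuclideanSpace ℂ (Fin m)) :
    ‖complexOp M v - complexOp N v‖ ≤ ‖v‖ * ∑ i, ∑ j, |M i j - N i j| := by
  have e : complexOp M v - complexOp N v =
      ∑ i, EuclideanSpace.single i (∑ j, ((M i j - N i j : ℝ) : ℂ) * v j) := by
    ext l
    simp [complexOp, Matrix.mulVec, dotProduct, sub_mul, Finset.sum_apply, Pi.single_apply]
  rw [e, Finset.mul_sum]
  refine (norm_sum_le _ _).trans (Finset.sum_le_sum fun i _ => ?_)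
  rw [PiLp.norm_single, Finset.mul_sum]
  refine (norm_sum_le _ _).trans (Finset.sum_le_sum fun j _ => ?_)
  rw [norm_mul, Complex.norm_real, Real.norm_eq_abs, mul_comm]
  gcongr
  exact PiLp.norm_apply_le v j

/-- A compactly supported admissible field which is constant, equal to `y`, near `x₀`. -/
theorem IsAdmissible.exists_background {φ : ℝ → ℝ} (h : IsAdmissible φ) {I : Set ℝ}
    (hI : IsOpen I) {x₀ : ℝ} (hx₀ : x₀ ∈ I) {y : EuclideanSpace ℂ (Fin m)} (hy : y ≠ 0) :
    ∃ u : ℝ → EuclideanSpace ℂ (Fin m), IsC1c I u ∧ IsC1c I (fun x => φ ‖u x‖ • u x) ∧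
      ∃ R > 0, Metric.closedBall x₀ R ⊆ I ∧ ∀ x ∈ Metric.ball x₀ R, u x = y := by
  obtain ⟨R, hR, hRI⟩ := Metric.nhds_basis_closedBall.mem_iff.1 (hI.mem_nhds hx₀)
  have hs : 0 < ‖y‖ := norm_pos_iff.2 hy
  -- A bare cutoff `f y` may fail to make `φ(|u|)u` of class `C¹` where `f` vanishes. With `u = f^k
  -- y` one has `|u| = |y| f^k`, and `φ(|u|)u` is the `C¹` function supplied by
  -- `exists_contDiff_pow`, evaluated at `f`, times `y/|y|`.
  obtain ⟨k, hk, hP⟩ := h.exists_contDiff_pow hs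
  let f : ContDiffBump x₀ := ⟨R / 2, R, by positivity, by linarith⟩
  have hf0 : ∀ x, x ∉ Metric.closedBall x₀ R → f x = 0 := fun x hx =>
    f.zero_of_le_dist (le_of_lt (by simpa using hx))
  have hf : ContDiff ℝ 1 f := f.contDiff
  have hnorm : ∀ x, ‖(f x) ^ k • y‖ = ‖y‖ * (f x) ^ k := fun x => by
    rw [norm_smul, Real.norm_of_nonneg (pow_nonneg f.nonneg _), mul_comm]
  refine ⟨fun x => (f x) ^ k • y, ?_, ?_, R / 2, by positivity,
    (Metric.closedBall_subset_closedBall (by linarith)).trans hRI, fun x hx => ?_⟩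
  · exact isC1c_of_eq_zero (isCompact_closedBall x₀ R) hRI ((hf.pow k).smul contDiff_const)
      fun x hx => by simp [hf0 x hx, hk]
  · refine isC1c_of_eq_zero (isCompact_closedBall x₀ R) hRI ?_ fun x hx => by simp [hf0 x hx, hk]
    have e : (fun x => φ ‖(f x) ^ k • y‖ • (f x) ^ k • y) = fun x =>
        ((‖y‖ * (max (f x) 0) ^ k) * φ (‖y‖ * (max (f x) 0) ^ k)) • (‖y‖⁻¹ • y) := by
      ext1 x
      rw [hnorm, max_eq_left f.nonneg, smul_smul, smul_smul]
      congr 1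
      field_simp
    rw [e]
    exact (hP.comp hf).smul contDiff_const
  · have : f x = 1 := f.one_of_mem_closedBall (Metric.ball_subset_closedBall hx)
    simp [this]

theorem IsAdmissible.contDiffAt_smul {φ : ℝ → ℝ} (h : IsAdmissible φ)
    {u : ℝ → EuclideanSpace ℂ (Fin m)} {x : ℝ} (hu : ContDiffAt ℝ 1 u x) (hx : u x ≠ 0) :
    ContDiffAt ℝ 1 (fun y => φ ‖u y‖ • u y) x := by
  have h1 : ContDiffAt ℝ 1 (fun y => ‖u y‖) x := hu.norm ℂ hx
  exact (ContDiffAt.comp (f := fun y => ‖u y‖) x (h.contDiffAt (norm_pos_iff.2 hx)) h1).smul hu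

theorem one_lt_abs_sub_div {x₀ x ε : ℝ} (hε : 0 < ε) (hx : x ∉ Metric.closedBall x₀ ε) :
    1 < |(x - x₀) / ε| := by
  rw [abs_div, abs_of_pos hε, one_lt_div hε, ← Real.dist_eq]
  simpa using hx

theorem deriv_eq_zero_of_one_lt_abs {ψ : ℝ → ℝ} (hψ0 : ∀ z, 1 ≤ |z| → ψ z = 0) {z : ℝ}
    (hz : 1 < |z|) : deriv ψ z = 0 := by
  have : ψ =ᶠ[𝓝 z] fun _ => 0 := by
    filter_upwards [(isOpen_lt continuous_const continuous_abs).mem_nhds hz] with t ht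
    exact hψ0 t (le_of_lt ht)
  rw [this.deriv_eq, deriv_const]

/-- The density of the dissipativity form of `u + δ ψ((x - x₀)/ε) v`, `u = y` near `x₀`. -/
theorem IsAdmissible.energy_perturbation {φ : ℝ → ℝ} (h : IsAdmissible φ) {I : Set ℝ} {x₀ : ℝ}
    {u : ℝ → EuclideanSpace ℂ (Fin m)} (hu : IsC1c I u)
    (hw : IsC1c I (fun x => φ ‖u x‖ • u x)) {R : ℝ} {y : EuclideanSpace ℂ (Fin m)}
    (hRI : Metric.closedBall x₀ R ⊆ I) (huR : ∀ x ∈ Metric.ball x₀ R, u x = y)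
    {ψ : ℝ → ℝ} (hψ : ContDiff ℝ 1 ψ) (hψ0 : ∀ z, 1 ≤ |z| → ψ z = 0)
    (v : EuclideanSpace ℂ (Fin m)) {δ ε : ℝ} (hε : 0 < ε) (hεR : ε < R)
    (hδ : ∀ z, y + (δ * ψ z) • v ≠ 0) :
    let U := fun x => u x + (δ * ψ ((x - x₀) / ε)) • v
    IsC1c I U ∧ IsC1c I (fun x => φ ‖U x‖ • U x) ∧
      ∀ (T : EuclideanSpace ℂ (Fin m) →ₗ[ℂ] EuclideanSpace ℂ (Fin m)) (x : ℝ),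
        (inner ℂ (deriv (fun x => φ ‖U x‖ • U x) x) (T (deriv U x))).re =
          (inner ℂ (deriv (fun x => φ ‖u x‖ • u x) x) (T (deriv u x))).re +
          (δ / ε) ^ 2 * deriv ψ ((x - x₀) / ε) ^ 2 *
            (inner ℂ (nlDeriv φ (y + (δ * ψ ((x - x₀) / ε)) • v) v) (T v)).re := by
  intro U
  have hrange : ∀ x, x ∉ Metric.closedBall x₀ ε → 1 < |(x - x₀) / ε| := fun x hx =>
    one_lt_abs_sub_div hε hx
  have hopen : IsOpen (Metric.closedBall x₀ ε)ᶜ := Metric.isClosed_closedBall.isOpen_compl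
  have hout : ∀ x, x ∉ Metric.closedBall x₀ ε → U =ᶠ[𝓝 x] u := by
    intro x hx
    filter_upwards [hopen.mem_nhds hx] with z hz
    simp [U, hψ0 _ (hrange z hz).le]
  have hball : Metric.closedBall x₀ ε ⊆ Metric.ball x₀ R := Metric.closedBall_subset_ball hεR
  have hin : ∀ x ∈ Metric.ball x₀ R, U x = y + (δ * ψ ((x - x₀) / ε)) • v := fun x hx => by
    simp only [U, huR x hx]
  have hpert : ContDiff ℝ 1 fun x => (δ * ψ ((x - x₀) / ε)) • v := by fun_prop
  have hU : ContDiff ℝ 1 U := hu.1.add hpert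
  have hC1 : IsC1c I U := by
    refine isC1c_of_eq_zero (hu.2.1.isCompact.union (isCompact_closedBall x₀ ε))
      (union_subset hu.2.2 ((hball.trans Metric.ball_subset_closedBall).trans hRI)) hU ?_
    intro x hx
    rw [mem_union, not_or] at hx
    rw [(hout x hx.2).self_of_nhds]
    exact image_eq_zero_of_notMem_tsupport hx.1
  have hWout : ∀ x, x ∉ Metric.closedBall x₀ ε →
      (fun x => φ ‖U x‖ • U x) =ᶠ[𝓝 x] fun x => φ ‖u x‖ • u x := fun x hx =>
    (hout x hx).mono fun z hz => by simp only [hz]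
  have hne : ∀ x ∈ Metric.ball x₀ R, U x ≠ 0 := fun x hx => by rw [hin x hx]; exact hδ _
  have hW : ContDiff ℝ 1 fun x => φ ‖U x‖ • U x := by
    rw [contDiff_iff_contDiffAt]
    intro x
    by_cases hx : x ∈ Metric.closedBall x₀ ε
    · exact h.contDiffAt_smul hU.contDiffAt (hne x (hball hx))
    · exact hw.1.contDiffAt.congr_of_eventuallyEq (hWout x hx)
  refine ⟨hC1, ⟨hW, ?_, ?_⟩, fun T x => ?_⟩
  · exact hC1.2.1.smul_left (f := fun x => φ ‖U x‖)
  · exact (tsupport_smul_subset_right (fun x => φ ‖U x‖) U).trans hC1.2.2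
  -- No cross terms occur: on the small ball `u` is constant, and off it the perturbation vanishes
  -- locally.
  by_cases hx : x ∈ Metric.closedBall x₀ ε
  · have hxR := hball hx
    have hu' : HasDerivAt u 0 x := (hasDerivAt_const x y).congr_of_eventuallyEq
      (mem_of_superset (Metric.isOpen_ball.mem_nhds hxR) huR)
    have hψ' : HasDerivAt (fun x => (δ * ψ ((x - x₀) / ε)) • v)
        ((δ / ε * deriv ψ ((x - x₀) / ε)) • v) x := by
      have h1 : HasDerivAt (fun x => (x - x₀) / ε) (1 / ε) x :=
        ((hasDerivAt_id x).sub_const x₀).div_const ε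
      have h2 : HasDerivAt (fun x => ψ ((x - x₀) / ε)) _ x :=
        HasDerivAt.comp (h := fun x => (x - x₀) / ε) x
          (hψ.differentiable one_ne_zero _).hasDerivAt h1
      refine ((h2.const_mul δ).smul_const v).congr_deriv ?_
      congr 1
      ring
    have hU' : HasDerivAt U ((δ / ε * deriv ψ ((x - x₀) / ε)) • v) x := by
      simpa using! hu'.add hψ'
    rw [hu'.deriv, map_zero, inner_zero_right, Complex.zero_re, zero_add, hU'.deriv,
      (h.hasDerivAt_smul hU' (hne x hxR)).deriv, hin x hxR, nlDeriv_smul,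
      ← Complex.coe_smul (δ / ε * deriv ψ ((x - x₀) / ε)) v,
      ← Complex.coe_smul (δ / ε * deriv ψ ((x - x₀) / ε)) (nlDeriv φ _ v), map_smul, inner_smul_left, inner_smul_right, Complex.conj_ofReal,
      Complex.re_ofReal_mul, Complex.re_ofReal_mul]
    ring
  · have hψ' : deriv ψ ((x - x₀) / ε) = 0 := deriv_eq_zero_of_one_lt_abs hψ0 (hrange x hx)
    rw [(hout x hx).deriv_eq, (hWout x hx).deriv_eq, hψ']
    ring

theorem IsC1c.re_setIntegral_inner {I : Set ℝ} {M : ℝ → Matrix (Fin m) (Fin m) ℝ}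
    (hM : ∀ i j, LocallyIntegrableOn (fun x => M x i j) I volume)
    {w u : ℝ → EuclideanSpace ℂ (Fin m)} (hw : IsC1c I w) (hu : IsC1c I u) :
    (∫ x in I, inner ℂ (deriv w x) (complexOp (M x) (deriv u x))).re =
      ∫ x, (inner ℂ (deriv w x) (complexOp (M x) (deriv u x))).re := by
  rw [hu.setIntegral_inner M]
  exact (integral_re (hw.integrable_inner hM hu)).symm

theorem tendsto_inv_mul_integral_sum {I : Set ℝ} (hI : IsOpen I)
    {M : ℝ → Matrix (Fin m) (Fin m) ℝ}
    (hM : ∀ i j, LocallyIntegrableOn (fun x => M x i j) I volume) {x₀ : ℝ} (hx₀ : x₀ ∈ I)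
    (hleb : ∀ i j, IsLebesguePoint (fun x => M x i j) x₀) :
    Tendsto (fun ε => ε⁻¹ * ∫ x in Metric.closedBall x₀ ε, ∑ i, ∑ j, |M x i j - M x₀ i j|)
      (𝓝[>] 0) (𝓝 0) := by
  obtain ⟨R, hR, hRI⟩ := Metric.nhds_basis_closedBall.mem_iff.1 (hI.mem_nhds hx₀)
  have h1 : Tendsto (fun ε => ∑ i, ∑ j,
      ε⁻¹ * ∫ x in Metric.closedBall x₀ ε, |M x i j - M x₀ i j|) (𝓝[>] 0) (𝓝 0) := by
    have := tendsto_finsetSum (Finset.univ : Finset (Fin m)) fun i _ =>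
      tendsto_finsetSum (Finset.univ : Finset (Fin m)) fun j _ => hleb i j
    simpa using this
  refine h1.congr' ?_
  filter_upwards [Ioo_mem_nhdsGT hR] with ε hε
  have hint : ∀ i j, IntegrableOn (fun x => |M x i j - M x₀ i j|) (Metric.closedBall x₀ ε) :=
    fun i j => (((hM i j).integrableOn_compact_subset
      ((Metric.closedBall_subset_closedBall hε.2.le).trans hRI)
      (isCompact_closedBall x₀ ε)).sub (integrableOn_const
        (isCompact_closedBall x₀ ε).measure_lt_top.ne)).abs
  rw [integral_finsetSum _ fun i _ => integrable_finsetSum _ fun j _ => hint i j, Finset.mul_sum]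
  refine Finset.sum_congr rfl fun i _ => ?_
  rw [integral_finsetSum _ fun j _ => hint i j, Finset.mul_sum]

theorem integrableOn_sum_abs_sub {I : Set ℝ}
    {M : ℝ → Matrix (Fin m) (Fin m) ℝ}
    (hM : ∀ i j, LocallyIntegrableOn (fun x => M x i j) I volume) (x₀ : ℝ) {K : Set ℝ}
    (hK : IsCompact K) (hKI : K ⊆ I) :
    IntegrableOn (fun x => ∑ i, ∑ j, |M x i j - M x₀ i j|) K :=
  integrable_finsetSum _ fun i _ => integrable_finsetSum _ fun j _ =>
    (((hM i j).integrableOn_compact_subset hKI hK).sub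
      (integrableOn_const hK.measure_lt_top.ne)).abs

/-- Separates the background energy, independent of `δ` and `ε`, from the perturbation energy; the
latter is integrable as a difference of integrable densities. -/
theorem IsLPhiDissipative.energy_nonneg {φ : ℝ → ℝ} (h : IsAdmissible φ) {I : Set ℝ}
    {M : ℝ → Matrix (Fin m) (Fin m) ℝ}
    (hM : ∀ i j, LocallyIntegrableOn (fun x => M x i j) I volume)
    (hdis : IsLPhiDissipative φ I fun x => (M x).map Complex.ofReal) {x₀ : ℝ}
    {u : ℝ → EuclideanSpace ℂ (Fin m)} (hu : IsC1c I u)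
    (hw : IsC1c I (fun x => φ ‖u x‖ • u x)) {R : ℝ} {y : EuclideanSpace ℂ (Fin m)}
    (hRI : Metric.closedBall x₀ R ⊆ I) (huR : ∀ x ∈ Metric.ball x₀ R, u x = y)
    {ψ : ℝ → ℝ} (hψ : ContDiff ℝ 1 ψ) (hψ0 : ∀ z, 1 ≤ |z| → ψ z = 0)
    (v : EuclideanSpace ℂ (Fin m)) {δ ε : ℝ} (hε : 0 < ε) (hεR : ε < R)
    (hδ : ∀ z, y + (δ * ψ z) • v ≠ 0) :
    Integrable (fun x => (δ / ε) ^ 2 * deriv ψ ((x - x₀) / ε) ^ 2 *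
      (inner ℂ (nlDeriv φ (y + (δ * ψ ((x - x₀) / ε)) • v) v) (complexOp (M x) v)).re) ∧
    0 ≤ (∫ x, (inner ℂ (deriv (fun x => φ ‖u x‖ • u x) x) (complexOp (M x) (deriv u x))).re) +
      ∫ x, (δ / ε) ^ 2 * deriv ψ ((x - x₀) / ε) ^ 2 *
      (inner ℂ (nlDeriv φ (y + (δ * ψ ((x - x₀) / ε)) • v) v) (complexOp (M x) v)).re := by
  obtain ⟨hU, hW, hF⟩ := h.energy_perturbation hu hw hRI huR hψ hψ0 v hε hεR hδ
  have h0 := hdis _ hU hW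
  rw [hW.re_setIntegral_inner hM hU] at h0
  have hint0 : Integrable fun x => (inner ℂ (deriv (fun x => φ ‖u x‖ • u x) x)
      (complexOp (M x) (deriv u x))).re := (hw.integrable_inner hM hu).re
  have hintU := (hW.integrable_inner hM hU).re
  have hF' := funext fun x => hF (complexOp (M x)) x
  simp only [RCLike.re_eq_complex_re] at hintU
  rw [hF'] at h0 hintU
  have hintG := (hintU.sub hint0).congr (Eventually.of_forall fun x => add_sub_cancel_left _ _)
  exact ⟨hintG, (integral_add hint0 hintG) ▸ h0⟩

/-- Freezing the coefficients at `x₀` leaves a negative main term of order `ε`; the freezing error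
is controlled by the oscillation of `M` on the ball, which is `o(ε)` at a Lebesgue point. -/
theorem integral_energy_le {I : Set ℝ} {M : ℝ → Matrix (Fin m) (Fin m) ℝ}
    (hM : ∀ i j, LocallyIntegrableOn (fun x => M x i j) I volume) {x₀ : ℝ}
    {ψ : ℝ → ℝ} (hψ0 : ∀ z, 1 ≤ |z| → ψ z = 0) (hψc : Continuous (deriv ψ))
    (hψs : HasCompactSupport (deriv ψ)) {D : ℝ} (hD : ∀ z, ‖deriv ψ z‖ ≤ D)
    {v : EuclideanSpace ℂ (Fin m)} {ε : ℝ} (hε : 0 < ε) (hballI : Metric.closedBall x₀ ε ⊆ I)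
    {a c C : ℝ} (ha : 0 ≤ a) (hC0 : 0 ≤ C) {N : ℝ → EuclideanSpace ℂ (Fin m)}
    (hN : ∀ x, ‖N x‖ ≤ C) (hNc : ∀ x, (inner ℂ (N x) (complexOp (M x₀) v)).re ≤ -c)
    (hint : Integrable fun x => a * deriv ψ ((x - x₀) / ε) ^ 2 *
      (inner ℂ (N x) (complexOp (M x) v)).re) :
    (∫ x, a * deriv ψ ((x - x₀) / ε) ^ 2 * (inner ℂ (N x) (complexOp (M x) v)).re) ≤
      a * (-c * (ε * ∫ z, deriv ψ z ^ 2) +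
        C * ‖v‖ * D ^ 2 * ∫ x in Metric.closedBall x₀ ε, ∑ i, ∑ j, |M x i j - M x₀ i j|) := by
  set β : ℝ → ℝ := fun x => ∑ i, ∑ j, |M x i j - M x₀ i j|
  have hβ0 : ∀ x, 0 ≤ β x := fun x =>
    Finset.sum_nonneg fun i _ => Finset.sum_nonneg fun j _ => abs_nonneg _
  have hψint : Integrable fun x => deriv ψ ((x - x₀) / ε) ^ 2 := by
    have hsq : Continuous fun z => deriv ψ z ^ 2 := hψc.pow 2
    have hsupp : HasCompactSupport fun z => deriv ψ z ^ 2 :=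
      hψs.mono fun z hz h0 => hz (by simp [h0])
    have h1 : Integrable (fun z => deriv ψ z ^ 2) := hsq.integrable_of_hasCompactSupport hsupp
    have h2 : Integrable (fun z => deriv ψ (z / ε) ^ 2) := h1.comp_div hε.ne'
    exact h2.comp_sub_right x₀
  have hψval : ∫ x, deriv ψ ((x - x₀) / ε) ^ 2 = ε * ∫ z, deriv ψ z ^ 2 := by
    rw [integral_sub_right_eq_self (fun x => deriv ψ (x / ε) ^ 2) x₀,
      Measure.integral_comp_div (fun z => deriv ψ z ^ 2) ε, abs_of_pos hε, smul_eq_mul]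
  have hβint : Integrable ((Metric.closedBall x₀ ε).indicator β) :=
    (integrableOn_sum_abs_sub hM x₀ (isCompact_closedBall x₀ ε) hballI).integrable_indicator
      Metric.isClosed_closedBall.measurableSet
  have hle := integral_mono hint (((hψint.const_mul (-c)).add
    (hβint.const_mul (C * ‖v‖ * D ^ 2))).const_mul a) (fun x => by
      change _ * _ * _ ≤ a * (-c * deriv ψ ((x - x₀) / ε) ^ 2 +
          C * ‖v‖ * D ^ 2 * (Metric.closedBall x₀ ε).indicator β x)
      rw [mul_assoc]
      refine mul_le_mul_of_nonneg_left ?_ ha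
      by_cases hx : x ∈ Metric.closedBall x₀ ε
      · rw [indicator_of_mem hx]
        have h1 : (inner ℂ (N x) (complexOp (M x) v)).re ≤ -c + C * (‖v‖ * β x) := by
          have h2 : (inner ℂ (N x) (complexOp (M x) v)).re =
              (inner ℂ (N x) (complexOp (M x₀) v)).re +
              (inner ℂ (N x) (complexOp (M x) v - complexOp (M x₀) v)).re := by
            rw [inner_sub_right, Complex.sub_re]; ring
          have h3 : (inner ℂ (N x) (complexOp (M x) v - complexOp (M x₀) v)).re ≤
              C * (‖v‖ * β x) :=
            (Complex.re_le_norm _).trans ((norm_inner_le_norm _ _).trans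
              (mul_le_mul (hN x) (norm_complexOp_sub_le _ _ _) (norm_nonneg _) hC0))
          linarith [hNc x]
        have h4 : deriv ψ ((x - x₀) / ε) ^ 2 ≤ D ^ 2 :=
          sq_le_sq.2 ((hD _).trans (le_abs_self D))
        have h5 : 0 ≤ C * (‖v‖ * β x) := by have := hβ0 x; positivity
        calc _ ≤ deriv ψ ((x - x₀) / ε) ^ 2 * (-c + C * (‖v‖ * β x)) := by gcongr
          _ = -c * deriv ψ ((x - x₀) / ε) ^ 2 +
              deriv ψ ((x - x₀) / ε) ^ 2 * (C * (‖v‖ * β x)) := by ring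
          _ ≤ -c * deriv ψ ((x - x₀) / ε) ^ 2 + D ^ 2 * (C * (‖v‖ * β x)) := by gcongr
          _ = _ := by ring
      · have : deriv ψ ((x - x₀) / ε) = 0 :=
          deriv_eq_zero_of_one_lt_abs hψ0 (one_lt_abs_sub_div hε hx)
        simp [this, indicator_of_notMem hx])
  refine hle.trans_eq ?_
  simp only [Pi.add_apply]
  rw [integral_const_mul, integral_add (hψint.const_mul (-c)) (hβint.const_mul _),
    integral_const_mul, integral_const_mul, hψval,
    integral_indicator Metric.isClosed_closedBall.measurableSet]

/-- Dissipativity implies the pointwise inequality at the Lebesgue points of the coefficients. -/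
theorem IsLPhiDissipative.re_inner_nlDeriv_nonneg {φ : ℝ → ℝ} (h : IsAdmissible φ) {I : Set ℝ}
    (hI : IsOpen I) {M : ℝ → Matrix (Fin m) (Fin m) ℝ}
    (hM : ∀ i j, LocallyIntegrableOn (fun x => M x i j) I volume)
    (hdis : IsLPhiDissipative φ I fun x => (M x).map Complex.ofReal) {x₀ : ℝ} (hx₀ : x₀ ∈ I)
    (hleb : ∀ i j, IsLebesguePoint (fun x => M x i j) x₀) {y : EuclideanSpace ℂ (Fin m)}
    (hy : y ≠ 0) (v : EuclideanSpace ℂ (Fin m)) :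
    0 ≤ (inner ℂ (nlDeriv φ y v) (complexOp (M x₀) v)).re := by
  by_contra! hneg
  obtain ⟨c, hc, hc2⟩ : ∃ c, 0 < c ∧
      (inner ℂ (nlDeriv φ y v) (complexOp (M x₀) v)).re < -c :=
    ⟨-(inner ℂ (nlDeriv φ y v) (complexOp (M x₀) v)).re / 2, by linarith, by linarith⟩
  obtain ⟨u, hu, hw, R, hR, hRI, huR⟩ := h.exists_background hI hx₀ hy
  let f : ContDiffBump (0 : ℝ) := ⟨1 / 2, 1, by norm_num, by norm_num⟩
  set ψ : ℝ → ℝ := ⇑f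
  have hψ : ContDiff ℝ 1 ψ := f.contDiff
  have hψ0 : ∀ z, 1 ≤ |z| → ψ z = 0 := fun z hz => f.zero_of_le_dist (by simpa using hz)
  have hψ1 : ∀ z, |ψ z| ≤ 1 := fun z => by
    rw [abs_of_nonneg f.nonneg]; exact f.le_one
  have hψc : Continuous (deriv ψ) := hψ.continuous_deriv le_rfl
  have hψs : HasCompactSupport (deriv ψ) := f.hasCompactSupport.deriv
  obtain ⟨D, hD⟩ := hψs.exists_bound_of_continuous hψc
  have hK : 0 < ∫ z, deriv ψ z ^ 2 := by
    have hne : ∃ z, deriv ψ z ≠ 0 := by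
      by_contra! hz
      have h1 := is_const_of_deriv_eq_zero (hψ.differentiable one_ne_zero) hz 0 1
      rw [hψ0 1 (by simp), show ψ 0 = 1 from f.one_of_mem_closedBall
        (Metric.mem_closedBall_self (by norm_num))] at h1
      exact one_ne_zero h1
    obtain ⟨z, hz⟩ := hne
    exact (hψc.pow 2).integral_pos_of_hasCompactSupport_nonneg_nonzero
      (hψs.comp_left (g := fun t => t ^ 2) (by simp)) (fun z => sq_nonneg _)
      (x := z) (pow_ne_zero 2 hz)
  set K := ∫ z, deriv ψ z ^ 2
  set C := ‖nlDeriv φ y v‖ + 1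
  have hcont := h.continuousAt_nlDeriv hy v
  have hev : ∀ᶠ z in 𝓝 y, z ≠ 0 ∧ ‖nlDeriv φ z v‖ ≤ C ∧
      (inner ℂ (nlDeriv φ z v) (complexOp (M x₀) v)).re ≤ -c := by
    have c1 : ContinuousAt
        (fun z => (inner ℂ (nlDeriv φ z v) (complexOp (M x₀) v)).re) y :=
      Complex.continuous_re.continuousAt.comp (ContinuousAt.inner (𝕜 := ℂ) hcont continuousAt_const)
    filter_upwards [isOpen_ne.mem_nhds hy,
      hcont.norm.eventually (gt_mem_nhds (lt_add_one ‖nlDeriv φ y v‖)),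
      c1.eventually (gt_mem_nhds hc2)] with z h1 h2 h3
    exact ⟨h1, le_of_lt h2, le_of_lt h3⟩
  obtain ⟨η, hη, hball⟩ := Metric.eventually_nhds_iff.1 hev
  set E₀ := ∫ x, (inner ℂ (deriv (fun x => φ ‖u x‖ • u x) x) (complexOp (M x) (deriv u x))).re
  set β : ℝ → ℝ := fun x => ∑ i, ∑ j, |M x i j - M x₀ i j|
  have hC0 : 0 ≤ C := by positivity
  set C' := C * ‖v‖ * D ^ 2
  have main : ∀ᶠ δ in 𝓝[>] (0 : ℝ), 0 ≤ δ * E₀ - c * K +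
      C' * ((δ ^ 3)⁻¹ * ∫ x in Metric.closedBall x₀ (δ ^ 3), β x) := by
    have e1 : ∀ᶠ δ in 𝓝[>] (0 : ℝ), δ ^ 3 < R := by
      have : Tendsto (fun δ : ℝ => δ ^ 3) (𝓝[>] 0) (𝓝 0) := by
        have := (continuous_pow (M := ℝ) 3).tendsto 0
        rw [zero_pow three_ne_zero] at this
        exact this.mono_left nhdsWithin_le_nhds
      exact this.eventually (gt_mem_nhds hR)
    have e2 : ∀ᶠ δ in 𝓝[>] (0 : ℝ), δ * ‖v‖ < η := by
      have : Tendsto (fun δ : ℝ => δ * ‖v‖) (𝓝[>] 0) (𝓝 0) := by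
        have := (by fun_prop : Continuous fun δ : ℝ => δ * ‖v‖).tendsto 0
        rw [zero_mul] at this
        exact this.mono_left nhdsWithin_le_nhds
      exact this.eventually (gt_mem_nhds hη)
    filter_upwards [self_mem_nhdsWithin, e1, e2] with δ hδ hδR hδη
    have hδ : 0 < δ := hδ
    -- The perturbation energy scales as `(δ/ε)² ε = δ²/ε`, hence as `1/δ`; multiplied by `δ`, the
    -- total becomes `δE₀ - cK + o(1)`.
    set ε := δ ^ 3 with hεdef
    have hε : 0 < ε := by positivity
    have hnear : ∀ z, dist (y + (δ * ψ z) • v) y < η := by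
      intro z
      rw [dist_self_add_left, norm_smul, norm_mul, Real.norm_eq_abs, Real.norm_eq_abs,
        abs_of_pos hδ]
      refine lt_of_le_of_lt ?_ hδη
      gcongr
      exact mul_le_of_le_one_right hδ.le (hψ1 z)
    obtain ⟨hint, h0⟩ := hdis.energy_nonneg h hM hu hw hRI huR hψ hψ0 v hε hδR
      fun z => (hball (hnear z)).1
    have hle := integral_energy_le hM hψ0 hψc hψs hD hε
      ((Metric.closedBall_subset_closedBall hδR.le).trans hRI) (sq_nonneg (δ / ε)) hC0
      (fun x => (hball (hnear ((x - x₀) / ε))).2.1) (fun x => (hball (hnear ((x - x₀) / ε))).2.2)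
      hint
    have h6 : 0 ≤ δ * (E₀ + (δ / ε) ^ 2 * (-c * (ε * K) +
        C' * ∫ x in Metric.closedBall x₀ ε, β x)) := mul_nonneg hδ.le (by linarith)
    convert h6 using 1
    rw [hεdef]
    field_simp
    ring
  have hlim : Tendsto (fun δ : ℝ => δ * E₀ - c * K +
      C' * ((δ ^ 3)⁻¹ * ∫ x in Metric.closedBall x₀ (δ ^ 3), β x)) (𝓝[>] 0)
      (𝓝 (0 * E₀ - c * K + C' * 0)) := by
    have t0 : Tendsto (fun δ : ℝ => δ) (𝓝[>] 0) (𝓝 0) := tendsto_id.mono_left nhdsWithin_le_nhds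
    have t3 : Tendsto (fun δ : ℝ => δ ^ 3) (𝓝[>] 0) (𝓝[>] 0) := by
      refine tendsto_nhdsWithin_iff.2 ⟨by simpa using t0.pow 3, ?_⟩
      filter_upwards [self_mem_nhdsWithin] with δ hδ
      exact pow_pos (mem_Ioi.1 hδ) 3
    exact ((t0.mul_const E₀).sub_const _).add
      (((tendsto_inv_mul_integral_sum hI hM hx₀ hleb).comp t3).const_mul C')
  -- In the limit `0 ≤ -cK`, contradicting `c, K > 0`.
  have := ge_of_tendsto hlim main
  nlinarith [mul_pos hc hK]

/-! ### Sufficiency: from the pointwise inequality to dissipativity. -/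

theorem reForm_pos_of_spectrum {E : Type*} [NormedAddCommGroup E] [InnerProductSpace ℂ E]
    [FiniteDimensional ℂ E] {T : E →ₗ[ℂ] E} (hT : T.IsSymmetric) {p q : ℝ} (hp : 0 < p)
    (hq : p ≤ q) (hpq : ∀ l : ℝ, Module.End.HasEigenvalue T (l : ℂ) → p ≤ l ∧ l ≤ q) {v : E}
    (hv : v ≠ 0) : 0 < reForm T v v := by
  have hn : 0 < ‖v‖ ^ 2 := by positivity
  have hq0 : 0 < q := hp.trans_le hq
  have h0 : 0 ≤ reForm T v v := by simpa using kantorovich_reForm hT hp hpq v v 0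
  refine h0.lt_of_ne fun hz => ?_
  -- If `S(v, v) = 0`, this `t` minimizes the quadratic in the Kantorovich inequality, with negative
  -- minimum `-pq/(p+q) ‖v‖²`.
  have h1 := kantorovich_reForm hT hp hpq v v (p * q / (p + q))
  have hvv : (inner ℂ v v).re = ‖v‖ ^ 2 := by rw [← @inner_self_eq_norm_sq ℂ]; rfl
  rw [← hz, hvv] at h1
  have e : 0 - 2 * (p * q / (p + q)) * ‖v‖ ^ 2 +
      (p * q / (p + q)) ^ 2 * (((p + q) * ‖v‖ ^ 2 - 0) / (p * q)) =
      -(p * q / (p + q) * ‖v‖ ^ 2) := by field_simp; ring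
  rw [e] at h1
  have : 0 < p * q / (p + q) * ‖v‖ ^ 2 := by positivity
  linarith

/-- The integrand is nonnegative almost everywhere. Positivity must be strict because the argument
at a zero of `u` needs `Re⟨u', M u'⟩ > 0` to persist for nearby difference quotients. -/
theorem isLPhiDissipative_of_ae {φ : ℝ → ℝ} (h : IsAdmissible φ) {I : Set ℝ}
    {M : ℝ → Matrix (Fin m) (Fin m) ℝ}
    (hM : ∀ i j, LocallyIntegrableOn (fun x => M x i j) I volume)
    (H : ∀ᵐ x ∂(volume.restrict I), (complexOp (M x)).IsSymmetric ∧
      PointwiseDissipative (LambdaInftySq φ) (complexOp (M x)) ∧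
      ∀ v, v ≠ 0 → 0 < reForm (complexOp (M x)) v v) :
    IsLPhiDissipative φ I fun x => (M x).map Complex.ofReal := by
  intro u hu hw
  have hre : (∫ x in I, inner ℂ (deriv (fun y => φ ‖u y‖ • u y) x)
      (complexOp (M x) (deriv u x))).re =
      ∫ x in I, (inner ℂ (deriv (fun y => φ ‖u y‖ • u y) x) (complexOp (M x) (deriv u x))).re :=
    (integral_re (hw.integrable_inner hM hu).integrableOn).symm
  rw [hre]
  refine integral_nonneg_of_ae (H.mono fun x hx => ?_)
  obtain ⟨hsym, hpt, hpos⟩ := hx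
  change 0 ≤ (inner ℂ _ _).re
  have hux := hu.hasDerivAt x
  by_cases hz : u x = 0
  · by_cases hd : deriv u x = 0
    · simp [hd]
    · exact h.re_inner_nonneg_of_eq_zero hux (hw.hasDerivAt x) hz (hpos _ hd)
  · rw [(h.hasDerivAt_smul hux hz).deriv]
    refine hpt.re_inner_nonneg h hsym (fun v => ?_) hz _
    rcases eq_or_ne v 0 with rfl | hv
    · simp [reForm]
    · exact (hpos v hv).le

/-! ### The shift by `κ` and the equivalence with the eigenvalue condition. -/

theorem map_ofReal_sub_smul_one (M : Matrix (Fin m) (Fin m) ℝ) (κ : ℝ) :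
    M.map Complex.ofReal - (κ : ℂ) • (1 : Matrix (Fin m) (Fin m) ℂ) =
      (M - κ • (1 : Matrix (Fin m) (Fin m) ℝ)).map Complex.ofReal := by
  ext i j
  by_cases hij : i = j <;> simp [hij]

theorem zero_lt_essInfOn_iff {I : Set ℝ} {f : ℝ → ℝ} :
    0 < essInfOn I f ↔ ∃ c : ℝ, 0 < c ∧ ∀ᵐ x ∂(volume.restrict I), c ≤ f x := by
  constructor
  · intro hf
    obtain ⟨c, hc0, hc⟩ := EReal.lt_iff_exists_real_btwn.1 hf
    refine ⟨c, by exact_mod_cast hc0, ?_⟩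
    filter_upwards [ae_lt_of_lt_essInf hc] with x hx
    exact_mod_cast hx.le
  · rintro ⟨c, hc, hf⟩
    have h1 : (c : EReal) ≤ essInfOn I f :=
      le_essInf_of_ae_le _ (hf.mono fun x hx => EReal.coe_le_coe_iff.2 hx)
    exact lt_of_lt_of_le (by exact_mod_cast hc) h1

theorem locallyIntegrableOn_sub_smul_one {I : Set ℝ} {A : ℝ → Matrix (Fin m) (Fin m) ℝ}
    (hA : ∀ i j, LocallyIntegrableOn (fun x => A x i j) I volume) (κ : ℝ) (i j : Fin m) :
    LocallyIntegrableOn (fun x => (A x - κ • (1 : Matrix (Fin m) (Fin m) ℝ)) i j) I volume :=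
  (hA i j).sub (locallyIntegrableOn_const _)

theorem exists_dissipative_iff {φ : ℝ → ℝ} (h : IsAdmissible φ) (hΛ : LambdaInftySq φ < 1)
    {I : Set ℝ} (hI : IsOpen I) (hm : 1 ≤ m) {A : ℝ → Matrix (Fin m) (Fin m) ℝ}
    (hA : ∀ i j, LocallyIntegrableOn (fun x => A x i j) I volume)
    (hsymm : ∀ᵐ x ∂(volume.restrict I), (A x).IsSymm) :
    (∃ κ : ℝ, 0 < κ ∧ IsLPhiDissipative φ I
        (fun x => (A x).map Complex.ofReal - (κ : ℂ) • (1 : Matrix (Fin m) (Fin m) ℂ))) ↔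
      0 < essInfOn I (fun x => (1 + √(1 - LambdaInftySq φ)) * minEigenvalue (A x) -
        (1 - √(1 - LambdaInftySq φ)) * maxEigenvalue (A x)) := by
  simp only [map_ofReal_sub_smul_one]
  rw [zero_lt_essInfOn_iff]
  set L := LambdaInftySq φ
  have hL0 : 0 ≤ L := h.LambdaInftySq_nonneg
  set σ := √(1 - L) 
  have hσ : 0 < σ := Real.sqrt_pos.2 (by linarith)
  have hσ2 : σ ^ 2 = 1 - L := Real.sq_sqrt (by linarith)
  have hsymm' : ∀ κ : ℝ, ∀ M : Matrix (Fin m) (Fin m) ℝ, M.IsSymm →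
      (M - κ • (1 : Matrix (Fin m) (Fin m) ℝ)).IsSymm := fun κ M hM =>
    hM.sub (Matrix.isSymm_one.smul κ)
  constructor
  · rintro ⟨κ, hκ, hdis⟩
    -- Exactly the amount by which the shift lowers `(1+σ)μ₁ - (1-σ)μ_m`.
    refine ⟨2 * σ * κ, by positivity, ?_⟩
    have hM := locallyIntegrableOn_sub_smul_one hA κ
    have hleb : ∀ᵐ x ∂(volume.restrict I), ∀ i j, IsLebesguePoint
        (fun x => (A x - κ • (1 : Matrix (Fin m) (Fin m) ℝ)) i j) x :=
      ae_all_iff.2 fun i => ae_all_iff.2 fun j => ae_isLebesguePoint hI (hM i j)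
    filter_upwards [hsymm, hleb, ae_restrict_mem hI.measurableSet] with x hs hl hx
    have hsT := complexOp_isSymmetric (hsymm' κ _ hs)
    have hpt := pointwiseDissipative_of_forall h hsT fun y hy v =>
      hdis.re_inner_nlDeriv_nonneg h hI hM hx hl hy v
    have hp := hasEigenvalue_minEigenvalue hm hs
    have hq := hasEigenvalue_maxEigenvalue hm hs
    have := spectrum_le_of_reForm_le hsT
      (p := minEigenvalue (A x) - κ) (q := maxEigenvalue (A x) - κ)
      (sub_le_sub_right (mem_Icc_of_hasEigenvalue hp).2 κ) hΛ
      ((hasEigenvalue_complexOp_iff _ _).2 ((hasEigenvalue_sub_smul_one_iff _ _ _).2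
        (by rwa [sub_add_cancel])))
      ((hasEigenvalue_complexOp_iff _ _).2 ((hasEigenvalue_sub_smul_one_iff _ _ _).2
        (by rwa [sub_add_cancel]))) hpt
    change (1 - σ) * _ ≤ (1 + σ) * _ at this
    linarith
  · rintro ⟨c, hc, hae⟩
    -- This shift consumes only `2σκ = c/2`, so the eigenvalue inequality stays strict; strictness
    -- then gives `p > 0`.
    refine ⟨c / (4 * σ), by positivity, ?_⟩
    set κ := c / (4 * σ)
    have hκ : 2 * σ * κ = c / 2 := by simp only [κ]; field_simp; norm_num
    refine isLPhiDissipative_of_ae h (locallyIntegrableOn_sub_smul_one hA κ) ?_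
    filter_upwards [hsymm, hae] with x hs hx
    have hsT := complexOp_isSymmetric (hsymm' κ _ hs)
    set p := minEigenvalue (A x) - κ with hpdef
    set q := maxEigenvalue (A x) - κ with hqdef
    have hq : p ≤ q :=
      sub_le_sub_right (mem_Icc_of_hasEigenvalue (hasEigenvalue_minEigenvalue hm hs)).2 κ
    have hσpq : (1 - σ) * q < (1 + σ) * p := by rw [hpdef, hqdef]; linarith
    have hσ1 : σ ≤ 1 := (sq_le_one_iff₀ hσ.le).1 (by linarith)
    have hp : 0 < p := by nlinarith [mul_nonneg (sub_nonneg.2 hσ1) (sub_nonneg.2 hq)]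
    have hpq : ∀ l : ℝ, Module.End.HasEigenvalue
        (complexOp (A x - κ • (1 : Matrix (Fin m) (Fin m) ℝ))) (l : ℂ) → p ≤ l ∧ l ≤ q := by
      intro l hl
      rw [hasEigenvalue_complexOp_iff, hasEigenvalue_sub_smul_one_iff] at hl
      have := mem_Icc_of_hasEigenvalue hl
      constructor <;> linarith [this.1, this.2]
    -- Square `q - p ≤ σ(p+q)` and use `(p+q)² - (q-p)² = 4pq`.
    have hLpq : L * (p + q) ^ 2 ≤ 4 * (p * q) := by
      have h1 : (q - p) ^ 2 ≤ (σ * (p + q)) ^ 2 :=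
        pow_le_pow_left₀ (sub_nonneg.2 hq) (by linarith) 2
      rw [mul_pow, hσ2] at h1
      linarith
    exact ⟨hsT, fun w hw v => reForm_le_of_spectrum hsT hp hq hpq hL0 hLpq hw v,
      fun v hv => reForm_pos_of_spectrum hsT hp hq hpq hv⟩

end FunctionalDissipativity

theorem mainTheorem9
    (φ : ℝ → ℝ) (hφ : FunctionalDissipativity.IsAdmissible φ)
    (hΛ : FunctionalDissipativity.LambdaInftySq φ < 1)
    (a b : EReal) (hab : a < b)
    (m : ℕ) (hm : 1 ≤ m)
    (A : ℝ → Matrix (Fin m) (Fin m) ℝ)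
    (hA : ∀ i j, LocallyIntegrableOn (fun x => A x i j)
      (FunctionalDissipativity.openInterval a b) volume)
    (hsymm : ∀ᵐ x ∂(volume.restrict (FunctionalDissipativity.openInterval a b)), (A x).IsSymm) :
    ((∃ κ : ℝ, 0 < κ ∧
        FunctionalDissipativity.IsLPhiDissipative φ (FunctionalDissipativity.openInterval a b)
          (fun x => (A x).map Complex.ofReal - (κ : ℂ) • (1 : Matrix (Fin m) (Fin m) ℂ))) ↔
      0 < FunctionalDissipativity.essInfOn (FunctionalDissipativity.openInterval a b)
        (fun x =>
          (1 + √(1 - FunctionalDissipativity.LambdaInftySq φ)) *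
              FunctionalDissipativity.minEigenvalue (A x) -
            (1 - √(1 - FunctionalDissipativity.LambdaInftySq φ)) *
              FunctionalDissipativity.maxEigenvalue (A x))) ∧
    (m = 2 →
      (0 < FunctionalDissipativity.essInfOn (FunctionalDissipativity.openInterval a b)
          (fun x =>
            (1 + √(1 - FunctionalDissipativity.LambdaInftySq φ)) *
                FunctionalDissipativity.minEigenvalue (A x) -
              (1 - √(1 - FunctionalDissipativity.LambdaInftySq φ)) *
                FunctionalDissipativity.maxEigenvalue (A x)) ↔
        0 < FunctionalDissipativity.essInfOn (FunctionalDissipativity.openInterval a b)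
          (fun x =>
            √(1 - FunctionalDissipativity.LambdaInftySq φ) * (A x).trace -
              √((A x).trace ^ 2 - 4 * (A x).det)))) := by
  refine ⟨FunctionalDissipativity.exists_dissipative_iff hφ hΛ
    (FunctionalDissipativity.isOpen_openInterval a b) hm hA hsymm, ?_⟩
  rintro rfl
  have e : FunctionalDissipativity.essInfOn (FunctionalDissipativity.openInterval a b) (fun x =>
      (1 + √(1 - FunctionalDissipativity.LambdaInftySq φ)) *
          FunctionalDissipativity.minEigenvalue (A x) -
        (1 - √(1 - FunctionalDissipativity.LambdaInftySq φ)) *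
          FunctionalDissipativity.maxEigenvalue (A x)) =
      FunctionalDissipativity.essInfOn (FunctionalDissipativity.openInterval a b) (fun x =>
        √(1 - FunctionalDissipativity.LambdaInftySq φ) * (A x).trace -
          √((A x).trace ^ 2 - 4 * (A x).det)) := by
    refine essInf_congr_ae (hsymm.mono fun x hx => ?_)
    exact congrArg Real.toEReal (FunctionalDissipativity.eigenvalues_fin_two hx _)
  rw [e]
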